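/- **Model.** The typical user is at the origin $0$ of $\mathbb R^2$. Let $\lambda_{BS},\lambda_b,\alpha>0$, $0\le\mu\le1$, $0\le L_{\min}<L_{\max}$, $\tau\ge 0$, and let $(\rho_k)_{k\in\mathcal M}$ be a probability mass function with $\rho_k>0$ on a set $\mathcal M$ of positive integers. Base stations (BSs) form a homogeneous Poisson point process (PPP) $\Psi_{BS}$ of density $\lambda_{BS}$. Blockages are line segments whose midpoints form a PPP of density $\lambda_b$, with i.i.d. lengths $L$ uniform on $[L_{\min},L_{\max}]$ and i.i.d. angles uniform on $[0,2\pi]$. Reconfigurable intelligent surfaces (RISs) are located at the points of a PPP of density $\lambda_R=\mu\lambda_b$; independently, each of them has $k$ meta-surfaces with probability $\rho_k$, lies on a segment whose angle is uniform on $[0,2\pi]$, and covers one side of that segment. For a link between two points $a,b$ let $\delta^{a,b}=1$ if no blockage meets the segment $[a,b]$ and $\delta^{a,b}=0$ otherwise; let $\kappa_z^{y}=1$ if both $0$ and $y$ face the RIS-equipped side of the RIS at $z$, and $\kappa_z^y=0$ otherwise. As an independence assumption of the model, different links experience independent copies of the blockage process, and different BSs see independent copies of the RIS process (so that, given $\Psi_{BS}$,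 the path-losses of different BSs are independent). For $y\in\Psi_{BS}$ and $k\in\mathcal M$ put (with $1/0=\infty$) $$\mathrm{PL}^d(y)=\frac1{\delta^{0,y}\|y\|^{-\alpha}},\qquad \mathrm{PL}^{i,k}(y)=\frac1{k^2(1-\delta^{0,y})\max_{z}\delta^{0,z}\delta^{y,z}\kappa_z^{y}(\|z\|+\|y-z\|)^{-\alpha}},$$ the maximum being over the RISs $z$ with $k$ meta-surfaces (and $0$ if there is none), and $\mathrm{PL}(y)=\min(\mathrm{PL}^d(y),\min_{k\in\mathcal M}\mathrm{PL}^{i,k}(y))$. The user associates with a BS $y^*\in\Psi_{BS}$ that minimizes $\mathrm{PL}$. **Functions.** Let $\beta=2\lambda_b\mathbb E[L]/\pi$, $P_{\rm LoS}(r)=e^{-\beta r}$, $P_{\rm NLoS}=1-P_{\rm LoS}$, $$F_{R_d}(x)=1-\exp\Big(-\frac{2\pi\lambda_{BS}}{\beta^2}\big(1-(\beta x+1)e^{-\beta x}\big)\Big),$$ $$a_i(r,t,\phi)=\tfrac12P_{\rm LoS}(t)\,P_{\rm LoS}\big(\sqrt{r^2+t^2-2rt\cos\phi}\big)\Big(1-\tfrac1\pi\arccos\tfrac{t-r\cos\phi}{\sqrt{t^2+r^2-2rt\cos\phi}}\Big),$$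 $$F_{R_{i,k}|r}(x)=\begin{cases}0,&x<r,\\1-\exp\Big(-\lambda_R\rho_k\int_{-\pi}^{\pi}\int_0^{\frac{x^2-r^2}{2(x-r\cos\phi)}}a_i(r,t,\phi)\,t\,dt\,d\phi\Big),&x\ge r,\end{cases}$$ $$\mathcal H(x)=\exp\Big(-2\pi\lambda_{BS}\int_0^\infty P_{\rm NLoS}(r)\Big(1-\prod_{k\in\mathcal M}\big(1-F_{R_{i,k}|r}(xk^{2/\alpha})\big)\Big)r\,dr\Big).$$ **Theorem (coverage probability).** The function $F_{R_d}$ is, on $[0,\infty)$, the distribution function of the distance $R_d$ from the user to the nearest BS $y$ with $\delta^{0,y}=1$ (with $R_d=\infty$ if there is none). The probability that the path-loss between the user and the associated BS is at most $\tau$ is $$P_{\rm cov}=\mathbb P\big(\mathrm{PL}(y^*)\le\tau\big)=1-\big(1-F_{R_d}(\tau^{1/\alpha})\big)\,\mathcal H(\tau^{1/\alpha}).$$ -/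

import Mathlib

open MeasureTheory ProbabilityTheory

-- The nested mark spaces below are products with many factors.
set_option synthInstance.maxSize 1000

namespace RISNet

/-- The Euclidean plane. -/
abbrev Plane := EuclideanSpace ℝ (Fin 2)

/-! ### Point configurations, Poisson point processes, independent marking -/

/-- An enumerated point configuration: the number of points (possibly infinite) together with a
list of positions, of which only those with index below the number of points are used. -/
abbrev PointConfig (X : Type) := ℕ∞ × (ℕ → X)

/-- An enumerated configuration of points of `X` with marks in `M`. -/
abbrev MarkedConfig (X M : Type) := PointConfig X × (ℕ → M)

/-- The number of points of a configuration in a set. -/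
noncomputable def count {X : Type} (B : Set X) (c : PointConfig X) : ℕ∞ :=
  Set.encard {n : ℕ | (n : ℕ∞) < c.1 ∧ c.2 n ∈ B}

/-- `Q` is the law of a Poisson point process with intensity measure `Λ`: the number of points in
a set of finite intensity is Poisson distributed, and the numbers of points in disjoint sets are
independent. -/
structure IsPoissonProcess {X : Type} [MeasurableSpace X] (Q : Measure (PointConfig X))
    (Λ : Measure X) : Prop where
  isProbabilityMeasure : IsProbabilityMeasure Q
  count_law : ∀ B : Set X, MeasurableSet B → Λ B ≠ ⊤ →
    Q.map (count B) = (poissonMeasure (Λ B).toNNReal).map (fun n : ℕ => (n : ℕ∞))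
  count_indep : ∀ (m : ℕ) (B : Fin m → Set X), (∀ i, MeasurableSet (B i)) →
    Pairwise (fun i j => Disjoint (B i) (B j)) → iIndepFun (fun i => count (B i)) Q

/-- `Q` is the law of a homogeneous Poisson point process of density `lam` in the plane. -/
def IsHomogeneousPPP (Q : Measure (PointConfig Plane)) (lam : ℝ) : Prop :=
  IsPoissonProcess Q (ENNReal.ofReal lam • (volume : Measure Plane))

/-- Independent marking: the points have law `Q`, the marks are i.i.d. with law `ν` and
independent of the points. -/
noncomputable def markedLaw {X M : Type} [MeasurableSpace X] [MeasurableSpace M]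
    (Q : Measure (PointConfig X)) (ν : Measure M) : Measure (MarkedConfig X M) :=
  Q.prod (Measure.infinitePi (fun _ : ℕ => ν))

/-- The `n`-th point is really a point of the configuration. -/
def Present {X M : Type} (c : MarkedConfig X M) (n : ℕ) : Prop := (n : ℕ∞) < c.1.1

/-- Location of the `n`-th point. -/
def loc {X M : Type} (c : MarkedConfig X M) (n : ℕ) : X := c.1.2 n

/-- Mark of the `n`-th point. -/
def mark {X M : Type} (c : MarkedConfig X M) (n : ℕ) : M := c.2 n

/-! ### The line Boolean model of blockages -/

/-- Uniform distribution on the interval `[a, b]`. -/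
noncomputable def uniformLaw (a b : ℝ) : Measure ℝ := cond volume (Set.Icc a b)

/-- A configuration of blockages: midpoints, marked with (length, angle). -/
abbrev BlockageField := MarkedConfig Plane (ℝ × ℝ)

/-- Law of the line Boolean model with midpoints of law `Q`, lengths uniform on `[Lmin, Lmax]` and
angles uniform on `[0, 2π]`. -/
noncomputable def blockageLaw (Q : Measure (PointConfig Plane)) (Lmin Lmax : ℝ) :
    Measure BlockageField :=
  markedLaw Q ((uniformLaw Lmin Lmax).prod (uniformLaw 0 (2 * Real.pi)))

/-- Unit vector with angle `θ` to the positive `x`-axis. -/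
noncomputable def dir (θ : ℝ) : Plane := !₂[Real.cos θ, Real.sin θ]

/-- The line segment with midpoint `z`, length `L` and angle `θ`. -/
noncomputable def blockage (z : Plane) (L θ : ℝ) : Set Plane :=
  segment ℝ (z - (L / 2) • dir θ) (z + (L / 2) • dir θ)

/-- No blockage obstructs the straight path between `a` and `b`. -/
def Clear (f : BlockageField) (a b : Plane) : Prop :=
  ∀ n, Present f n → Disjoint (blockage (loc f n) (mark f n).1 (mark f n).2) (segment ℝ a b)

open Classical in
/-- The line-of-sight indicator `δ` of the path between `a` and `b`. -/
noncomputable def losInd (f : BlockageField) (a b : Plane) : ENNReal :=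
  if Clear f a b then 1 else 0

/-! ### The reconfigurable intelligent surfaces seen by one base station -/

/-- Mark of an RIS: number of meta-surfaces, orientation angle, and the blockage fields
experienced by the user-RIS link and by the RIS-BS link. -/
abbrev RISMark := ℕ × ℝ × BlockageField × BlockageField

/-- A configuration of RISs. -/
abbrev RISField := MarkedConfig Plane RISMark

/-- Law of a field of RISs: midpoints of law `QR`, numbers of meta-surfaces of law `ρ`, angles
uniform on `[0, 2π]`, and for each of the two links of each RIS an independent blockage field of
law `B`. -/
noncomputable def risLaw (QR : Measure (PointConfig Plane)) (ρ : PMF ℕ)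
    (B : Measure BlockageField) : Measure RISField :=
  markedLaw QR (ρ.toMeasure.prod ((uniformLaw 0 (2 * Real.pi)).prod (B.prod B)))

/-- Normal vector on the RIS-equipped side (the left one of the direction `θ`; since `θ` is uniform
on `[0, 2π]`, both sides of the blockage are equally likely to be equipped). -/
noncomputable def risNormal (θ : ℝ) : Plane := !₂[-Real.sin θ, Real.cos θ]

open Classical in
/-- The indicator `κ`: the user at the origin and the base station at `y` both face the
RIS-equipped side of the blockage with midpoint `z` and angle `θ`. -/
noncomputable def facing (z : Plane) (θ : ℝ) (y : Plane) : ENNReal :=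
  if 0 < inner ℝ (0 - z) (risNormal θ) ∧ 0 < inner ℝ (y - z) (risNormal θ) then 1 else 0

/-! ### The network, seen by the typical user at the origin -/

/-- A configuration of base stations; the mark consists of the blockage field experienced by the
direct user-BS link and of the field of RISs seen by the pair (user, BS). -/
abbrev Network := MarkedConfig Plane (BlockageField × RISField)

/-- Law of the network: base stations of law `QS`; all links experience independent copies of the
blockage process, and different base stations see independent copies of the RIS process. -/
noncomputable def networkLaw (QS QR Qb : Measure (PointConfig Plane)) (ρ : PMF ℕ)
    (Lmin Lmax : ℝ) : Measure Network :=
  markedLaw QS ((blockageLaw Qb Lmin Lmax).prod (risLaw QR ρ (blockageLaw Qb Lmin Lmax)))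

/-- `PL^d(y) = 1 / (δ ‖y‖^(-α))`, with `1 / 0 = ∞`. -/
noncomputable def directPathLoss (α : ℝ) (f : BlockageField) (y : Plane) : ENNReal :=
  (losInd f 0 y * ENNReal.ofReal ‖y‖ ^ (-α))⁻¹

/-- `PL^{i,k}(y) = 1 / (k² (1 - δ) max_z δ δ κ (‖z‖ + ‖y - z‖)^(-α))`, with `1 / 0 = ∞`, the maximum
being over the RISs `z` with `k` meta-surfaces. -/
noncomputable def indirectPathLoss (α : ℝ) (f : BlockageField) (R : RISField) (k : ℕ)
    (y : Plane) : ENNReal :=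
  ((k : ENNReal) ^ 2 * (1 - losInd f 0 y) *
    ⨆ (i : ℕ) (_ : Present R i) (_ : (mark R i).1 = k),
      losInd (mark R i).2.2.1 0 (loc R i) * losInd (mark R i).2.2.2 (loc R i) y *
        facing (loc R i) (mark R i).2.1 y *
        ENNReal.ofReal (‖loc R i‖ + ‖y - loc R i‖) ^ (-α))⁻¹

/-- `PL(y)` for the `n`-th base station: the smallest of the direct path-loss and the indirect
path-losses over the possible numbers of meta-surfaces. -/
noncomputable def pathLoss (α : ℝ) (ρ : PMF ℕ) (N : Network) (n : ℕ) : ENNReal :=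
  min (directPathLoss α (mark N n).1 (loc N n))
    (⨅ k ∈ ρ.support, indirectPathLoss α (mark N n).1 (mark N n).2 k (loc N n))

/-- The `n`-th base station provides the lowest average path-loss among all base stations. -/
def IsAssociated (α : ℝ) (ρ : PMF ℕ) (N : Network) (n : ℕ) : Prop :=
  Present N n ∧ ∀ m, Present N m → pathLoss α ρ N n ≤ pathLoss α ρ N m

/-- The event that the path-loss between the user and the associated base station is at
most `τ`. -/
def coverageEvent (α : ℝ) (ρ : PMF ℕ) (τ : ℝ) : Set Network :=
  {N | ∃ n, IsAssociated α ρ N n ∧ pathLoss α ρ N n ≤ ENNReal.ofReal τ}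

/-- `R_d`: distance from the user to the nearest base station in direct line of sight
(`∞` if there is none). -/
noncomputable def nearestLoSDist (N : Network) : ENNReal :=
  ⨅ (n : ℕ) (_ : Present N n) (_ : Clear (mark N n).1 0 (loc N n)), ENNReal.ofReal ‖loc N n‖

/-! ### The functions of the analytical expression -/

/-- `β = 2 λ_b E[L] / π`. -/
noncomputable def beta (lamb Lmin Lmax : ℝ) : ℝ :=
  2 * lamb * (∫ l, l ∂(uniformLaw Lmin Lmax)) / Real.pi

/-- `P_LoS(r) = exp(-β r)`. -/
noncomputable def pLoS (β r : ℝ) : ℝ := Real.exp (-(β * r))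

/-- `F_{R_d}(x)`. -/
noncomputable def cdfRd (lamBS β x : ℝ) : ℝ :=
  1 - Real.exp (-(2 * Real.pi * lamBS * (1 / β ^ 2) * (1 - (β * x + 1) * Real.exp (-(β * x)))))

/-- `C(r, t, φ)`. -/
noncomputable def reflC (r t φ : ℝ) : ℝ :=
  1 - 1 / Real.pi *
    Real.arccos ((t - r * Real.cos φ) / √(t ^ 2 + r ^ 2 - 2 * r * t * Real.cos φ))

/-- `a_i(r, t, φ)`. -/
noncomputable def reflProb (β r t φ : ℝ) : ℝ :=
  1 / 2 * pLoS β t * pLoS β √(r ^ 2 + t ^ 2 - 2 * r * t * Real.cos φ) * reflC r t φ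

/-- `F_{R_{i,k}|r}(x)`; `lamk` is the density of the RISs with `k` meta-surfaces. -/
noncomputable def cdfRik (β lamk r x : ℝ) : ℝ :=
  if x < r then 0
  else 1 - Real.exp (-(lamk * ∫ φ in (-Real.pi)..Real.pi,
    ∫ t in (0 : ℝ)..((x ^ 2 - r ^ 2) / (2 * (x - r * Real.cos φ))), reflProb β r t φ * t))

/-- `H(x)`. -/
noncomputable def funH (lamBS lamR β α : ℝ) (ρ : PMF ℕ) (x : ℝ) : ℝ :=
  Real.exp (-(2 * Real.pi * lamBS * ∫ r in Set.Ioi (0 : ℝ),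
    (1 - pLoS β r) *
      (1 - ∏' k : ρ.support,
        (1 - cdfRik β (lamR * (ρ k).toReal) r (x * ((k : ℕ) : ℝ) ^ (2 / α)))) * r))

end RISNet

namespace RISNet

open Filter Topology

/-! Everything reduces to one fact about independently marked Poisson processes: the number of
points whose (location, mark) lies in `A` vanishes with probability `exp (-(Λ ⊗ ν) A)`
(`markedLaw_void`). Given the points, the i.i.d. marks make this event a product of factors `1 -
q(x)`, with `q(x)` the probability that a point at `x` is hit; its mean is the Laplace functional at
`-log (1 - q)`. The Laplace functional itself comes from the laws of counts on disjoint sets: simple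
functions, then limits.

The fact is used three times. For blockages it gives the line-of-sight probability: the midpoints of
segments of fixed length and angle that cut a link fill a parallelogram, and averaging its area
produces `β` (`blockageLaw_clear`). For RISs it gives the law of the best reflected path: facing and
the two clear links are independent, and the resulting weight is integrated over an ellipse with
foci at the user and the base station (`risIntensity_eq`, `toReal_ellipseMass`). For base stations
it gives coverage: a station reaches loss `τ` either directly or, if its direct link is blocked,
through an RIS. These cases are disjoint, so their intensities add (`intensity_netScore`) and the
void probability factors as `(1 - F_{R_d}) * H`.

Two analytic points remain. Minima over possibly infinite configurations are attained almost surely,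
since finite intensity implies finitely many points (`markedLaw_finite`). The integrals are finite
by an exponentially decaying bound on the ellipse mass (`ellipseMass_le`). -/

/-! ### The function `s ↦ exp (-s)` on `[0, ∞]` -/

/-- `exp (-s)` for `s ∈ [0, ∞]`, with `exp (-∞) = 0`. -/
noncomputable def expNeg (s : ENNReal) : ENNReal := (EReal.exp (s : EReal))⁻¹

lemma one_le_exp_coe (s : ENNReal) : 1 ≤ EReal.exp (s : EReal) := by
  rw [EReal.one_le_exp_iff]; exact EReal.coe_ennreal_nonneg s

lemma expNeg_zero : expNeg 0 = 1 := by simp [expNeg]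

lemma expNeg_le_one (s : ENNReal) : expNeg s ≤ 1 :=
  ENNReal.inv_le_one.2 (one_le_exp_coe s)

lemma expNeg_add (s t : ENNReal) : expNeg (s + t) = expNeg s * expNeg t := by
  have h : ∀ s : ENNReal, EReal.exp (s : EReal) ≠ 0 := fun s =>
    (lt_of_lt_of_le one_pos (one_le_exp_coe s)).ne'
  rw [expNeg, EReal.coe_ennreal_add, EReal.exp_add, ENNReal.mul_inv (Or.inl (h s)) (Or.inr (h t))]
  rfl

lemma expNeg_sum {ι : Type*} (S : Finset ι) (f : ι → ENNReal) :
    expNeg (∑ i ∈ S, f i) = ∏ i ∈ S, expNeg (f i) := by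
  classical
  induction S using Finset.induction_on with
  | empty => simp [expNeg_zero]
  | insert a S ha ih => rw [Finset.sum_insert ha, Finset.prod_insert ha, expNeg_add, ih]

lemma continuous_expNeg : Continuous expNeg :=
  continuous_inv.comp (ENNReal.continuous_exp.comp continuous_coe_ennreal_ereal)

lemma measurable_expNeg : Measurable expNeg := continuous_expNeg.measurable

lemma expNeg_antitone : Antitone expNeg := fun _ _ h =>
  ENNReal.inv_le_inv.2 (EReal.exp_monotone (EReal.coe_ennreal_le_coe_ennreal_iff.2 h))

lemma expNeg_ofReal {x : ℝ} (hx : 0 ≤ x) :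
    expNeg (ENNReal.ofReal x) = ENNReal.ofReal (Real.exp (-x)) := by
  rw [expNeg, EReal.coe_ennreal_ofReal, max_eq_left hx, EReal.exp_coe, Real.exp_neg,
    ENNReal.ofReal_inv_of_pos (Real.exp_pos x)]

lemma expNeg_eq_ofReal {s : ENNReal} (hs : s ≠ ⊤) :
    expNeg s = ENNReal.ofReal (Real.exp (-s.toReal)) := by
  rw [← expNeg_ofReal ENNReal.toReal_nonneg, ENNReal.ofReal_toReal hs]

/-- Continuity of `expNeg` on all of `[0, ∞]`, including `∞`, carries the finite identity to the
limit; divergent sums simply give product `0`. -/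
lemma expNeg_tsum {ι : Type*} (f : ι → ENNReal) :
    expNeg (∑' i, f i) = ∏' i, expNeg (f i) := by
  have h : HasProd (fun i => expNeg (f i)) (expNeg (∑' i, f i)) := by
    have := (continuous_expNeg.tendsto (∑' i, f i)).comp (ENNReal.summable (f := f)).hasSum
    simpa only [HasProd, Function.comp_def, expNeg_sum] using this
  exact h.tprod_eq.symm

lemma one_sub_expNeg_le (s : ENNReal) : 1 - expNeg s ≤ s := by
  rcases eq_or_ne s ⊤ with rfl | hs
  · exact le_top
  rw [expNeg_eq_ofReal hs, ← ENNReal.ofReal_one, ← ENNReal.ofReal_sub _ (Real.exp_pos _).le]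
  refine ENNReal.ofReal_le_of_le_toReal ?_
  linarith [Real.add_one_le_exp (-s.toReal)]

/-- `-log q` for `q ∈ [0, 1]`, with value `∞` at `0`. -/
noncomputable def negLog (q : ENNReal) : ENNReal := (ENNReal.log q⁻¹).toENNReal

lemma measurable_negLog : Measurable negLog :=
  measurable_ereal_toENNReal.comp (ENNReal.measurable_log.comp measurable_inv)

lemma expNeg_negLog {q : ENNReal} (hq : q ≤ 1) : expNeg (negLog q) = q := by
  have : 0 ≤ ENNReal.log q⁻¹ := ENNReal.zero_le_log_iff.2 (ENNReal.one_le_inv.2 hq)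
  rw [expNeg, negLog, EReal.coe_toENNReal this, ENNReal.exp_log, inv_inv]

/-! ### The Poisson distribution -/

lemma lintegral_poissonMeasure (r : NNReal) (f : ℕ → ENNReal) :
    ∫⁻ n, f n ∂poissonMeasure r
      = ∑' n : ℕ, ENNReal.ofReal (Real.exp (-r) * r ^ n / n.factorial) * f n := by
  simp [poissonMeasure, lintegral_sum_measure]

lemma lintegral_natCast_poissonMeasure (r : NNReal) :
    ∫⁻ n, (n : ENNReal) ∂poissonMeasure r = r := by
  rw [lintegral_poissonMeasure, tsum_eq_zero_add' ENNReal.summable]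
  have h (n : ℕ) : ENNReal.ofReal (Real.exp (-r) * r ^ (n + 1) / (n + 1).factorial)
      * ((n + 1 : ℕ) : ENNReal) = r * ENNReal.ofReal (Real.exp (-r) * r ^ n / n.factorial) := by
    rw [← ENNReal.ofReal_natCast, ← ENNReal.ofReal_mul (by positivity), ← ENNReal.ofReal_coe_nnreal,
      ← ENNReal.ofReal_mul (by positivity), Nat.factorial_succ]
    congr 1
    push_cast
    field_simp
    ring
  simp only [h, ENNReal.tsum_mul_left]
  have := (hasSum_one_poissonMeasure r)
  rw [← ENNReal.ofReal_tsum_of_nonneg (fun n => by positivity) this.summable, this.tsum_eq]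
  simp

/-- Absorbing `exp (-v n)` into `r ^ n` leaves the exponential series at `r * exp (-v)`. Finite `v`
suffices, because the approximating simple functions are finite. -/
lemma lintegral_expNeg_poissonMeasure (r : NNReal) {v : ENNReal} (hv : v ≠ ⊤) :
    ∫⁻ n : ℕ, expNeg (v * n) ∂poissonMeasure r = expNeg ((1 - expNeg v) * r) := by
  lift v to NNReal using hv
  rw [lintegral_poissonMeasure]
  have h (n : ℕ) : ENNReal.ofReal (Real.exp (-r) * r ^ n / n.factorial) * expNeg (v * n)
      = ENNReal.ofReal (Real.exp (-r) * ((r * Real.exp (-v)) ^ n / n.factorial)) := by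
    rw [expNeg_eq_ofReal (ENNReal.mul_ne_top ENNReal.coe_ne_top (ENNReal.natCast_ne_top n)),
      ← ENNReal.ofReal_mul (by positivity)]
    congr 1
    simp only [ENNReal.toReal_mul, ENNReal.coe_toReal, ENNReal.toReal_natCast, mul_pow,
      ← Real.exp_nat_mul]
    ring_nf
  have hs := (NormedSpace.expSeries_div_hasSum_exp ((r : ℝ) * Real.exp (-v))).mul_left
    (Real.exp (-r))
  rw [← Real.exp_eq_exp_ℝ, ← Real.exp_add] at hs
  simp only [h]
  rw [← ENNReal.ofReal_tsum_of_nonneg (fun n => by positivity) hs.summable, hs.tsum_eq,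
    expNeg_eq_ofReal ENNReal.coe_ne_top, ← ENNReal.ofReal_one,
    ← ENNReal.ofReal_sub _ (Real.exp_pos _).le, ← ENNReal.ofReal_coe_nnreal (p := r),
    ← ENNReal.ofReal_mul (by simp), expNeg_ofReal]
  · congr 2; simp; ring
  · have : Real.exp (-(v : ℝ)) ≤ 1 := by simp
    have : 0 ≤ (1 - Real.exp (-(v : ℝ))) := by linarith
    simp only [ENNReal.coe_toReal]
    positivity

/-! ### Poisson point processes: mean measure, Laplace functional -/

section Poisson

variable {X M : Type} [MeasurableSpace X] [MeasurableSpace M]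

/-- The counting measure of a configuration. -/
noncomputable def cfgMeasure (c : PointConfig X) : Measure X :=
  Measure.sum fun n : ℕ => if (n : ℕ∞) < c.1 then Measure.dirac (c.2 n) else 0

lemma lintegral_cfgMeasure {f : X → ENNReal} (hf : Measurable f) (c : PointConfig X) :
    ∫⁻ x, f x ∂cfgMeasure c = ∑' n : ℕ, if (n : ℕ∞) < c.1 then f (c.2 n) else 0 := by
  rw [cfgMeasure, lintegral_sum_measure]
  refine tsum_congr fun n => ?_
  split_ifs
  · exact lintegral_dirac' _ hf
  · simp

lemma cfgMeasure_apply {B : Set X} (hB : MeasurableSet B) (c : PointConfig X) :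
    cfgMeasure c B = (count B c : ENNReal) := by
  classical
  rw [← lintegral_indicator_one hB, lintegral_cfgMeasure (measurable_one.indicator hB), count,
    ← ENNReal.tsum_set_one, tsum_subtype _ (fun _ => (1 : ENNReal))]
  refine tsum_congr fun n => ?_
  simp only [Set.indicator_apply, Set.mem_ofPred_eq, Pi.one_apply]
  split_ifs <;> simp_all

lemma measurableSet_lt_size (n : ℕ) : MeasurableSet {c : PointConfig X | (n : ℕ∞) < c.1} :=
  measurable_fst (MeasurableSet.of_discrete (s := Set.Ioi (n : ℕ∞)))

lemma measurable_point (n : ℕ) : Measurable fun c : PointConfig X => c.2 n :=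
  (measurable_pi_apply n).comp measurable_snd

lemma measurable_lintegral_cfgMeasure {f : X → ENNReal} (hf : Measurable f) :
    Measurable fun c : PointConfig X => ∫⁻ x, f x ∂cfgMeasure c := by
  simp only [lintegral_cfgMeasure hf]
  exact Measurable.tsum fun n =>
    Measurable.ite (measurableSet_lt_size n) (hf.comp (measurable_point n)) measurable_const

/-- `IsPoissonProcess` does not assert this, yet the law `Q.map (count B)` can only be unfolded with
it. -/
lemma measurable_count {B : Set X} (hB : MeasurableSet B) : Measurable (count B) := by
  have h := measurable_lintegral_cfgMeasure (measurable_one.indicator hB)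
  simp only [lintegral_indicator_one hB, cfgMeasure_apply hB] at h
  refine measurable_to_countable' fun m => ?_
  have : count B ⁻¹' {m} = (fun c => (count B c : ENNReal)) ⁻¹' {(m : ENNReal)} := by
    ext c; simp
  rw [this]
  exact h (measurableSet_singleton _)

lemma IsPoissonProcess.lintegral_count {Q : Measure (PointConfig X)} {Λ : Measure X}
    (hQ : IsPoissonProcess Q Λ) {B : Set X} (hB : MeasurableSet B) (hΛ : Λ B ≠ ⊤)
    (g : ℕ∞ → ENNReal) :
    ∫⁻ c, g (count B c) ∂Q = ∫⁻ n : ℕ, g n ∂poissonMeasure (Λ B).toNNReal := by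
  have hg : Measurable g := measurable_from_top
  rw [← lintegral_map hg (measurable_count hB), hQ.count_law B hB hΛ,
    lintegral_map hg measurable_from_top]

/-- Campbell's formula. -/
lemma IsPoissonProcess.lintegral_lintegral {Q : Measure (PointConfig X)} {Λ : Measure X}
    [SigmaFinite Λ] (hQ : IsPoissonProcess Q Λ) {f : X → ENNReal} (hf : Measurable f) :
    ∫⁻ c, ∫⁻ x, f x ∂cfgMeasure c ∂Q = ∫⁻ x, f x ∂Λ := by
  have hm : Measurable (cfgMeasure : PointConfig X → Measure X) := by
    refine Measure.measurable_of_measurable_coe _ fun B hB => ?_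
    simp only [cfgMeasure_apply hB]
    exact (measurable_from_top (f := fun m : ℕ∞ => (m : ENNReal))).comp (measurable_count hB)
  -- It suffices that the mean measure `Q.bind cfgMeasure` equals `Λ`. The count law settles sets of
  -- finite intensity; σ-finiteness exhausts the others.
  rw [← Measure.lintegral_bind hm.aemeasurable hf.aemeasurable]
  congr 1
  have key : ∀ B, MeasurableSet B → Λ B ≠ ⊤ → (Q.bind cfgMeasure) B = Λ B := by
    intro B hB hΛ
    rw [Measure.bind_apply hB hm.aemeasurable]
    simp only [cfgMeasure_apply hB]
    rw [hQ.lintegral_count hB hΛ (fun m => (m : ENNReal))]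
    simp [lintegral_natCast_poissonMeasure, ENNReal.coe_toNNReal hΛ]
  refine Measure.ext fun B hB => ?_
  have hU : B = ⋃ j, B ∩ spanningSets Λ j := by
    rw [← Set.inter_iUnion, iUnion_spanningSets, Set.inter_univ]
  have hmono : Monotone fun j => B ∩ spanningSets Λ j := fun i j h =>
    Set.inter_subset_inter_right _ (monotone_spanningSets Λ h)
  rw [hU, hmono.measure_iUnion, hmono.measure_iUnion]
  refine iSup_congr fun j => key _ (hB.inter (measurableSet_spanningSets Λ j)) ?_
  exact ((measure_mono Set.inter_subset_right).trans_lt (measure_spanningSets_lt_top Λ j)).ne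

/-- Level sets are disjoint, so their counts are independent and the expectation of the product
splits into Poisson Laplace transforms. -/
lemma IsPoissonProcess.laplace_simpleFunc {Q : Measure (PointConfig X)} {Λ : Measure X}
    (hQ : IsPoissonProcess Q Λ) (f : SimpleFunc X ENNReal) (hf : ∀ x, f x ≠ ⊤)
    (hs : ∀ v, v ≠ 0 → Λ (f ⁻¹' {v}) ≠ ⊤) :
    ∫⁻ c, expNeg (∫⁻ x, f x ∂cfgMeasure c) ∂Q = expNeg (∫⁻ x, (1 - expNeg (f x)) ∂Λ) := by
  classical
  -- The zero level set contributes nothing but may have infinite intensity, where the count law is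
  -- silent.
  set S := f.range.filter (· ≠ 0) with hS
  have hsum : ∀ (μ : Measure X) (g : ENNReal → ENNReal), g 0 = 0 →
      ∫⁻ x, g (f x) ∂μ = ∑ v ∈ S, g v * μ (f ⁻¹' {v}) := by
    intro μ g hg
    have : ∫⁻ x, g (f x) ∂μ = (f.map g).lintegral μ := by
      rw [← SimpleFunc.lintegral_eq_lintegral]; rfl
    rw [this, SimpleFunc.map_lintegral, hS, Finset.sum_filter]
    refine Finset.sum_congr rfl fun v _ => ?_
    split_ifs with h
    · rfl
    · rw [not_not] at h; simp [h, hg]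
  have hB : ∀ v, MeasurableSet (f ⁻¹' {v}) := fun v => f.measurableSet_fiber v
  have h1 : ∀ c : PointConfig X, expNeg (∫⁻ x, f x ∂cfgMeasure c)
      = ∏ v ∈ S, expNeg (v * count (f ⁻¹' {v}) c) := by
    intro c
    rw [hsum _ (fun v => v) rfl, expNeg_sum]
    simp only [cfgMeasure_apply (hB _)]
  simp only [h1]
  rw [hsum Λ (fun v => 1 - expNeg v) (by simp [expNeg_zero]), expNeg_sum]
  set e := S.equivFin.symm
  have hre : ∀ F : ENNReal → ENNReal, ∏ v ∈ S, F v = ∏ i, F (e i) := fun F => by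
    rw [← Finset.prod_coe_sort, ← e.prod_comp]
  simp only [hre]
  have hind := hQ.count_indep S.card (fun i => f ⁻¹' {(e i : ENNReal)}) (fun i => hB _) (by
    intro i j hij
    refine Disjoint.preimage _ (Set.disjoint_singleton.2 fun h => hij ?_)
    exact e.injective (Subtype.ext h))
  have hind' := hind.comp (fun i (m : ℕ∞) => expNeg ((e i : ENNReal) * m))
    (fun i => measurable_from_top)
  have := lintegral_prod_eq_prod_lintegral_of_indepFun Finset.univ _ hind'
    (fun i => measurable_from_top.comp (measurable_count (hB _)))
  simp only [Function.comp_def] at this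
  rw [this]
  refine Finset.prod_congr rfl fun i _ => ?_
  have hi := Finset.mem_filter.1 (e i).2
  have hΛ := hs _ hi.2
  obtain ⟨x, hx⟩ := SimpleFunc.mem_range.1 hi.1
  rw [hQ.lintegral_count (hB _) hΛ (fun m => expNeg ((e i : ENNReal) * m))]
  have := lintegral_expNeg_poissonMeasure (Λ (f ⁻¹' {(e i : ENNReal)})).toNNReal
    (v := (e i : ENNReal)) (by rw [← hx]; exact hf x)
  simpa [ENNReal.coe_toNNReal hΛ] using this

/-- The Laplace functional of a Poisson point process. -/
lemma IsPoissonProcess.laplace {Q : Measure (PointConfig X)} {Λ : Measure X}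
    [SigmaFinite Λ] (hQ : IsPoissonProcess Q Λ) {f : X → ENNReal} (hf : Measurable f) :
    ∫⁻ c, expNeg (∫⁻ x, f x ∂cfgMeasure c) ∂Q = expNeg (∫⁻ x, (1 - expNeg (f x)) ∂Λ) := by
  classical
  have := hQ.isProbabilityMeasure
  -- Cutting off at the spanning sets gives every nonzero level set finite intensity while keeping
  -- `F j` increasing to `f`.
  set F : ℕ → SimpleFunc X ENNReal := fun j => (SimpleFunc.eapprox f j).restrict (spanningSets Λ j)
  have hFx : ∀ j x, F j x = (spanningSets Λ j).indicator (SimpleFunc.eapprox f j) x := fun j x =>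
    SimpleFunc.restrict_apply _ (measurableSet_spanningSets Λ j) x
  have hmono : ∀ x, Monotone fun j => F j x := by
    intro x i j hij
    simp only [hFx, Set.indicator_apply]
    split_ifs with h1 h2
    · exact SimpleFunc.monotone_eapprox f hij x
    · exact absurd (monotone_spanningSets Λ hij h1) h2
    · exact zero_le
    · exact le_rfl
  have hlim : ∀ x, Tendsto (fun j => F j x) atTop (𝓝 (f x)) := by
    intro x
    have h1 : Tendsto (fun j => SimpleFunc.eapprox f j x) atTop (𝓝 (f x)) := by
      rw [← SimpleFunc.iSup_eapprox_apply hf x]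
      exact tendsto_atTop_iSup fun i j h => SimpleFunc.monotone_eapprox f h x
    refine h1.congr' ?_
    filter_upwards [eventually_ge_atTop (spanningSetsIndex Λ x)] with j hj
    rw [hFx, Set.indicator_of_mem]
    exact monotone_spanningSets Λ hj (mem_spanningSetsIndex Λ x)
  have hF : ∀ j, ∫⁻ c, expNeg (∫⁻ x, F j x ∂cfgMeasure c) ∂Q
      = expNeg (∫⁻ x, (1 - expNeg (F j x)) ∂Λ) := by
    intro j
    refine hQ.laplace_simpleFunc (F j) (fun x => ?_) fun v hv => ?_
    · rw [hFx, Set.indicator_apply]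
      split_ifs
      · exact (SimpleFunc.eapprox_lt_top f j x).ne
      · simp
    · refine ((measure_mono fun x hx => ?_).trans_lt (measure_spanningSets_lt_top Λ j)).ne
      by_contra h
      rw [Set.mem_preimage, hFx, Set.indicator_of_notMem h] at hx
      exact hv hx.symm
  have hL : Tendsto (fun j => ∫⁻ c, expNeg (∫⁻ x, F j x ∂cfgMeasure c) ∂Q) atTop
      (𝓝 (∫⁻ c, expNeg (∫⁻ x, f x ∂cfgMeasure c) ∂Q)) := by
    -- Here the integrands decrease in `j`, so the bound by `1` is used; on the `Λ` side `1 - expNeg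
    -- (F j x)` increases and monotone convergence applies.
    refine tendsto_lintegral_of_dominated_convergence (fun _ => 1)
      (fun j => measurable_expNeg.comp (measurable_lintegral_cfgMeasure (F j).measurable))
      (fun j => Eventually.of_forall fun c => expNeg_le_one _) (by simp)
      (Eventually.of_forall fun c => ?_)
    exact (continuous_expNeg.tendsto _).comp
      (lintegral_tendsto_of_tendsto_of_monotone (fun j => (F j).measurable.aemeasurable)
        (Eventually.of_forall hmono) (Eventually.of_forall hlim))
  have hR : Tendsto (fun j => expNeg (∫⁻ x, (1 - expNeg (F j x)) ∂Λ)) atTop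
      (𝓝 (expNeg (∫⁻ x, (1 - expNeg (f x)) ∂Λ))) := by
    refine (continuous_expNeg.tendsto _).comp
      (lintegral_tendsto_of_tendsto_of_monotone
        (fun j => (measurable_const.sub
          (measurable_expNeg.comp (F j).measurable)).aemeasurable)
        (Eventually.of_forall fun x i j h => ?_) (Eventually.of_forall fun x => ?_))
    · exact tsub_le_tsub_left (expNeg_antitone (hmono x h)) 1
    · exact ENNReal.Tendsto.sub tendsto_const_nhds
        ((continuous_expNeg.tendsto _).comp (hlim x)) (Or.inl (by simp))
  simp only [hF] at hL
  exact tendsto_nhds_unique hL hR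

/-! ### Independently marked Poisson processes -/

lemma measurableSet_present_mem {A : Set (X × M)} (hA : MeasurableSet A) (n : ℕ) :
    MeasurableSet {c : MarkedConfig X M | Present c n ∧ (loc c n, mark c n) ∈ A} :=
  (measurable_fst (measurableSet_lt_size n)).inter
    ((((measurable_point n).comp measurable_fst).prodMk
      ((measurable_pi_apply n).comp measurable_snd)) hA)

/-- The probability that a marked Poisson process has no point in `A`. -/
lemma IsPoissonProcess.markedLaw_void {Q : Measure (PointConfig X)} {Λ : Measure X}
    [SigmaFinite Λ] (hQ : IsPoissonProcess Q Λ) (ν : Measure M) [IsProbabilityMeasure ν]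
    {A : Set (X × M)} (hA : MeasurableSet A) :
    markedLaw Q ν {c | ∀ n, Present c n → (loc c n, mark c n) ∉ A} = expNeg ((Λ.prod ν) A) := by
  classical
  have := hQ.isProbabilityMeasure
  have hmeas : MeasurableSet {c : MarkedConfig X M | ∀ n, Present c n →
      (loc c n, mark c n) ∉ A} := by
    have : {c : MarkedConfig X M | ∀ n, Present c n → (loc c n, mark c n) ∉ A}
        = ⋂ n, {c | Present c n ∧ (loc c n, mark c n) ∈ A}ᶜ := by
      ext c; simp
    rw [this]
    exact MeasurableSet.iInter fun n => (measurableSet_present_mem hA n).compl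
  have hAx : ∀ x, MeasurableSet (Prod.mk x ⁻¹' A) := fun x => measurable_prodMk_left hA
  have hν : Measurable fun x => ν (Prod.mk x ⁻¹' A) := measurable_measure_prodMk_left hA
  -- With this `f`, which is `∞` where a mark hits almost surely, `1 - expNeg (f x)` is the hitting
  -- probability, so the Laplace functional yields `(Λ.prod ν) A`.
  set f : X → ENNReal := fun x => negLog (1 - ν (Prod.mk x ⁻¹' A)) with hfdef
  have hf : Measurable f := measurable_negLog.comp (measurable_const.sub hν)
  have hef : ∀ x, expNeg (f x) = 1 - ν (Prod.mk x ⁻¹' A) := fun x => expNeg_negLog tsub_le_self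
  rw [markedLaw, Measure.prod_apply hmeas]
  have hc : ∀ c : PointConfig X, Measure.infinitePi (fun _ : ℕ => ν)
      (Prod.mk c ⁻¹' {c : MarkedConfig X M | ∀ n, Present c n → (loc c n, mark c n) ∉ A})
      = expNeg (∫⁻ x, f x ∂cfgMeasure c) := by
    intro c
    -- For fixed points the event is a box in mark space, unconstrained at unused indices.
    have hset : Prod.mk c ⁻¹' {c : MarkedConfig X M | ∀ n, Present c n → (loc c n, mark c n) ∉ A}
        = Set.univ.pi fun n : ℕ =>
          if (n : ℕ∞) < c.1 then (Prod.mk (c.2 n) ⁻¹' A)ᶜ else Set.univ := by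
      ext m
      simp only [Set.mem_preimage, Set.mem_ofPred_eq, Set.mem_univ_pi, Present, loc, mark]
      refine forall_congr' fun n => ?_
      split_ifs with h <;> simp [h]
    rw [hset, Measure.infinitePi_pi_univ, lintegral_cfgMeasure hf, expNeg_tsum]
    · refine tprod_congr fun n => ?_
      split_ifs
      · rw [hef, measure_compl (hAx _) (measure_ne_top _ _), measure_univ]
      · simp [expNeg_zero]
    · intro n
      split_ifs
      · exact (hAx _).compl
      · exact MeasurableSet.univ
  simp only [hc]
  rw [hQ.laplace hf, Measure.prod_apply hA]
  congr 1
  refine lintegral_congr fun x => ?_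
  rw [hef, ENNReal.sub_sub_cancel ENNReal.one_ne_top prob_le_one]

/-- A marked Poisson process has only finitely many points in a set of finite intensity. -/
lemma IsPoissonProcess.markedLaw_finite {Q : Measure (PointConfig X)} {Λ : Measure X}
    [SigmaFinite Λ] (hQ : IsPoissonProcess Q Λ) (ν : Measure M) [IsProbabilityMeasure ν]
    {A : Set (X × M)} (hA : MeasurableSet A) (hfin : (Λ.prod ν) A ≠ ⊤) :
    ∀ᵐ c ∂markedLaw Q ν, {n | Present c n ∧ (loc c n, mark c n) ∈ A}.Finite := by
  classical
  have := hQ.isProbabilityMeasure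
  have hν : Measurable fun x => ν (Prod.mk x ⁻¹' A) := measurable_measure_prodMk_left hA
  -- Borel–Cantelli: by Campbell's formula the probabilities sum to `(Λ.prod ν) A`.
  refine ae_finite_setOfPred_mem (s := fun n => {c : MarkedConfig X M |
    Present c n ∧ (loc c n, mark c n) ∈ A}) ?_
  have hn : ∀ n, markedLaw Q ν {c | Present c n ∧ (loc c n, mark c n) ∈ A}
      = ∫⁻ c, (if (n : ℕ∞) < c.1 then ν (Prod.mk (c.2 n) ⁻¹' A) else 0) ∂Q := by
    intro n
    rw [markedLaw, Measure.prod_apply (measurableSet_present_mem hA n)]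
    refine lintegral_congr fun c => ?_
    split_ifs with h
    · have : Prod.mk c ⁻¹' {c : MarkedConfig X M | Present c n ∧ (loc c n, mark c n) ∈ A}
          = (fun m : ℕ → M => m n) ⁻¹' (Prod.mk (c.2 n) ⁻¹' A) := by
        ext m; simp [Present, loc, mark, h]
      rw [this]
      exact (measurePreserving_eval_infinitePi (fun _ : ℕ => ν) n).measure_preimage
        (measurable_prodMk_left hA).nullMeasurableSet
    · have : Prod.mk c ⁻¹' {c : MarkedConfig X M | Present c n ∧ (loc c n, mark c n) ∈ A} = ∅ := by
        ext m; simp [Present, h]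
      rw [this, measure_empty]
  simp only [hn]
  have hmeas : ∀ n : ℕ, AEMeasurable (fun c : PointConfig X =>
      if (n : ℕ∞) < c.1 then ν (Prod.mk (c.2 n) ⁻¹' A) else 0) Q := fun n =>
    (Measurable.ite (measurableSet_lt_size n) (hν.comp (measurable_point n))
      measurable_const).aemeasurable
  rw [← lintegral_tsum hmeas]
  simp only [← lintegral_cfgMeasure hν]
  rw [hQ.lintegral_lintegral hν, ← Measure.prod_apply hA]
  exact hfin

instance isProbabilityMeasure_markedLaw (Q : Measure (PointConfig X)) [IsProbabilityMeasure Q]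
    (ν : Measure M) [IsProbabilityMeasure ν] : IsProbabilityMeasure (markedLaw Q ν) := by
  unfold markedLaw; infer_instance

/-- The probability that a marked Poisson process has a point in `A`. -/
lemma IsPoissonProcess.markedLaw_exists {Q : Measure (PointConfig X)} {Λ : Measure X}
    [SigmaFinite Λ] (hQ : IsPoissonProcess Q Λ) (ν : Measure M) [IsProbabilityMeasure ν]
    {A : Set (X × M)} (hA : MeasurableSet A) :
    markedLaw Q ν {c | ∃ n, Present c n ∧ (loc c n, mark c n) ∈ A}
      = 1 - expNeg ((Λ.prod ν) A) := by
  have := hQ.isProbabilityMeasure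
  have hm : MeasurableSet {c : MarkedConfig X M | ∃ n, Present c n ∧ (loc c n, mark c n) ∈ A} := by
    simp only [Set.ofPred_exists]
    exact MeasurableSet.iUnion fun n => measurableSet_present_mem hA n
  rw [← hQ.markedLaw_void ν hA, ← prob_compl_eq_one_sub₀]
  · congr 1
    ext c; simp
  · have : {c : MarkedConfig X M | ∀ n, Present c n → (loc c n, mark c n) ∉ A}
      = {c : MarkedConfig X M | ∃ n, Present c n ∧ (loc c n, mark c n) ∈ A}ᶜ := by
      ext c; simp
    rw [this]
    exact hm.compl.nullMeasurableSet

/-- The law of the smallest score of a marked Poisson process. -/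
lemma IsPoissonProcess.markedLaw_iInf_le {Q : Measure (PointConfig X)} {Λ : Measure X}
    [SigmaFinite Λ] (hQ : IsPoissonProcess Q Λ) (ν : Measure M) [IsProbabilityMeasure ν]
    {s : X × M → ENNReal} (hs : Measurable s) {t t' : ENNReal} (htt : t < t')
    (hfin : (Λ.prod ν) {p | s p ≤ t'} ≠ ⊤) :
    markedLaw Q ν {c | ⨅ (n : ℕ) (_ : Present c n), s (loc c n, mark c n) ≤ t}
      = 1 - expNeg ((Λ.prod ν) {p | s p ≤ t}) := by
  rw [← hQ.markedLaw_exists ν (measurableSet_le hs measurable_const)]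
  refine measure_congr ?_
  -- An infimum at most `t` need not be attained. The room up to `t'` provides a point with score at
  -- most `t'`; almost surely only finitely many such points exist, so one of them is a minimiser.
  filter_upwards [hQ.markedLaw_finite ν (measurableSet_le hs measurable_const) hfin] with c hc
  refine propext ⟨fun h => ?_, fun ⟨n, hn, h⟩ => (iInf₂_le n hn).trans h⟩
  change ⨅ (n : ℕ) (_ : Present c n), s (loc c n, mark c n) ≤ t at h
  obtain ⟨n, hn⟩ := iInf_lt_iff.1 (h.trans_lt htt)
  obtain ⟨hp, hn⟩ := iInf_lt_iff.1 hn
  obtain ⟨m, hm, hmin⟩ := hc.exists_minimalFor (fun n => s (loc c n, mark c n)) _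
    ⟨n, hp, hn.le⟩
  refine ⟨m, hm.1, le_trans (le_iInf₂ fun k hk => ?_) h⟩
  by_cases hk' : s (loc c k, mark c k) ≤ t'
  · by_contra hlt
    exact hlt (hmin ⟨hk, hk'⟩ (not_le.1 hlt).le)
  · exact le_trans hm.2 (not_le.1 hk').le

end Poisson

/-! ### Plane geometry -/

lemma exists_eq_smul_dir (v : Plane) : ∃ φ : ℝ, v = ‖v‖ • dir φ := by
  set z : ℂ := ⟨v 0, v 1⟩
  have hz : ‖z‖ = ‖v‖ := by
    rw [EuclideanSpace.norm_eq, Complex.norm_def, Complex.normSq_apply]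
    simp [Fin.sum_univ_two, z, sq]
  refine ⟨z.arg, ?_⟩
  ext i
  fin_cases i
  · simp [dir, z, ← hz]
  · simp [dir, z, ← hz]

lemma continuous_dir : Continuous dir := by
  unfold dir
  fun_prop

lemma continuous_risNormal : Continuous risNormal := by
  unfold risNormal
  fun_prop

lemma mem_blockage {z p : Plane} {L θ : ℝ} :
    p ∈ blockage z L θ ↔ ∃ u ∈ Set.Icc (0 : ℝ) 1, z - (L / 2) • dir θ + u • (L • dir θ) = p := by
  rw [blockage, segment_eq_image']
  have : z + (L / 2) • dir θ - (z - (L / 2) • dir θ) = L • dir θ := by module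
  simp only [this, Set.mem_image]

/-- The intersection equation is solved for the midpoint. Reversing the blockage (`u ↦ 1 - u`) gives
both edge vectors a plus sign, as in `parallelepiped`. -/
lemma not_disjoint_blockage_iff {z a b : Plane} {L θ : ℝ} :
    ¬ Disjoint (blockage z L θ) (segment ℝ a b) ↔
      ∃ s ∈ Set.Icc (0 : ℝ) 1, ∃ u ∈ Set.Icc (0 : ℝ) 1,
        z = a - (L / 2) • dir θ + (s • (b - a) + u • (L • dir θ)) := by
  rw [Set.not_disjoint_iff]
  simp only [mem_blockage, segment_eq_image', Set.mem_image]
  constructor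
  · rintro ⟨p, ⟨u, hu, h1⟩, s, hs, h2⟩
    refine ⟨s, hs, 1 - u, ⟨by linarith [hu.2], by linarith [hu.1]⟩, ?_⟩
    have h3 : z = a + s • (b - a) + (L / 2) • dir θ - u • (L • dir θ) := by
      rw [h2, ← h1]; module
    rw [h3]; module
  · rintro ⟨s, hs, u, hu, h⟩
    refine ⟨_, ⟨1 - u, ⟨by linarith [hu.2], by linarith [hu.1]⟩, ?_⟩, s, hs, rfl⟩
    rw [h]; module

/-- The midpoints of the blockages of given length and angle that meet a segment form a
parallelogram. -/
lemma volume_not_disjoint_blockage (a b : Plane) (L θ : ℝ) :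
    volume {z : Plane | ¬ Disjoint (blockage z L θ) (segment ℝ a b)} =
      ENNReal.ofReal |L| *
        ENNReal.ofReal |(b - a) 0 * Real.sin θ - (b - a) 1 * Real.cos θ| := by
  have hset : {z : Plane | ¬ Disjoint (blockage z L θ) (segment ℝ a b)}
      = (fun w => (a - (L / 2) • dir θ) + w) '' parallelepiped ![b - a, L • dir θ] := by
    ext z
    simp only [Set.mem_ofPred_eq, not_disjoint_blockage_iff, Set.mem_image, mem_parallelepiped_iff,
      Fin.sum_univ_two, Matrix.cons_val_zero, Matrix.cons_val_one]
    constructor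
    · rintro ⟨s, hs, u, hu, h⟩
      refine ⟨_, ⟨![s, u], ?_, rfl⟩, ?_⟩
      · constructor <;> intro i <;> fin_cases i <;> simp [hs.1, hs.2, hu.1, hu.2]
      · simpa using h.symm
    · rintro ⟨w, ⟨t, ht, rfl⟩, h⟩
      exact ⟨t 0, ⟨ht.1 0, ht.2 0⟩, t 1, ⟨ht.1 1, ht.2 1⟩, h.symm⟩
  rw [hset, Set.image_add_left, measure_preimage_add,
    ← OrthonormalBasis.addHaar_eq_volume (EuclideanSpace.basisFun (Fin 2) ℝ),
    Measure.addHaar_parallelepiped, ← ENNReal.ofReal_mul (abs_nonneg _), ← abs_mul]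
  congr 2
  rw [Module.Basis.det_apply, Matrix.det_fin_two]
  simp [Module.Basis.toMatrix_apply, dir]
  ring

/-! ### The uniform distribution of the angles -/

lemma isProbabilityMeasure_uniformLaw {a b : ℝ} (h : a < b) :
    IsProbabilityMeasure (uniformLaw a b) :=
  cond_isProbabilityMeasure_of_finite (by simp [h]) (by simp)

instance : IsProbabilityMeasure (uniformLaw 0 (2 * Real.pi)) :=
  isProbabilityMeasure_uniformLaw (by positivity)

lemma lintegral_uniformLaw {a b : ℝ} (h : a < b) {g : ℝ → ℝ} (hg : IntervalIntegrable g volume a b)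
    (h0 : ∀ x ∈ Set.Icc a b, 0 ≤ g x) :
    ∫⁻ x, ENNReal.ofReal (g x) ∂uniformLaw a b
      = ENNReal.ofReal ((b - a)⁻¹ * ∫ x in a..b, g x) := by
  rw [uniformLaw, ProbabilityTheory.cond, lintegral_smul_measure, Real.volume_Icc, smul_eq_mul,
    ENNReal.ofReal_mul (by simpa using h.le), ENNReal.ofReal_inv_of_pos (by linarith),
    intervalIntegral.integral_of_le h.le, ← integral_Icc_eq_integral_Ioc,
    ofReal_integral_eq_lintegral_ofReal]
  · exact (intervalIntegrable_iff_integrableOn_Icc_of_le h.le).1 hg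
  · exact (ae_restrict_iff' measurableSet_Icc).2 (Eventually.of_forall h0)

lemma integral_uniformLaw {a b : ℝ} (h : a < b) :
    ∫ x, x ∂uniformLaw a b = (b - a)⁻¹ * ∫ x in a..b, x := by
  rw [uniformLaw, ProbabilityTheory.cond, integral_smul_measure, Real.volume_Icc, smul_eq_mul,
    intervalIntegral.integral_of_le h.le, ← integral_Icc_eq_integral_Ioc, ENNReal.toReal_inv,
    ENNReal.toReal_ofReal (by linarith)]

lemma integral_abs_sin_sub (φ : ℝ) : ∫ θ in (0 : ℝ)..(2 * Real.pi), |Real.sin (θ - φ)| = 4 := by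
  have hper : Function.Periodic (fun θ => |Real.sin (θ - φ)|) Real.pi := by
    intro θ
    simp only [add_sub_right_comm, Real.sin_add_pi, abs_neg]
  have hii : ∀ a b : ℝ, IntervalIntegrable (fun θ => |Real.sin (θ - φ)|) volume a b := fun a b =>
    Continuous.intervalIntegrable (by fun_prop) a b
  have h1 : ∀ s : ℝ, ∫ θ in s..(s + Real.pi), |Real.sin (θ - φ)| = 2 := by
    intro s
    rw [hper.intervalIntegral_add_eq s φ, intervalIntegral.integral_comp_sub_right
      (fun θ => |Real.sin θ|) φ]
    have : ∫ θ in (φ - φ)..(φ + Real.pi - φ), |Real.sin θ| = ∫ θ in (0 : ℝ)..Real.pi, Real.sin θ := by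
      rw [sub_self, add_sub_cancel_left]
      refine intervalIntegral.integral_congr fun θ hθ => ?_
      rw [Set.uIcc_of_le Real.pi_pos.le] at hθ
      exact abs_of_nonneg (Real.sin_nonneg_of_nonneg_of_le_pi hθ.1 hθ.2)
    rw [this, integral_sin]; simp; norm_num
  have h2 := intervalIntegral.integral_add_adjacent_intervals (hii 0 Real.pi)
    (hii Real.pi (2 * Real.pi))
  rw [← h2]
  have := h1 0
  rw [zero_add] at this
  have h3 := h1 Real.pi
  rw [← two_mul] at h3
  rw [this, h3]; norm_num

/-- The mean of `|sin|` over a full turn is `4 / (2π)`, the source of the `2 / π` in `β`. -/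
lemma lintegral_abs_cross_uniformLaw (v : Plane) :
    ∫⁻ θ, ENNReal.ofReal |v 0 * Real.sin θ - v 1 * Real.cos θ| ∂uniformLaw 0 (2 * Real.pi)
      = ENNReal.ofReal (2 / Real.pi * ‖v‖) := by
  obtain ⟨φ, hφ⟩ := exists_eq_smul_dir v
  have h (θ : ℝ) : |v 0 * Real.sin θ - v 1 * Real.cos θ| = ‖v‖ * |Real.sin (θ - φ)| := by
    have h0 : v 0 = ‖v‖ * Real.cos φ := by
      conv_lhs => rw [hφ]
      simp [dir]
    have h1 : v 1 = ‖v‖ * Real.sin φ := by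
      conv_lhs => rw [hφ]
      simp [dir]
    rw [h0, h1, Real.sin_sub]
    rw [← abs_of_nonneg (norm_nonneg v), ← abs_mul, abs_of_nonneg (norm_nonneg v)]
    congr 1; ring
  simp only [h]
  rw [lintegral_uniformLaw Real.two_pi_pos (Continuous.intervalIntegrable (by fun_prop) _ _)
    (fun _ _ => by positivity), intervalIntegral.integral_const_mul, integral_abs_sin_sub]
  congr 1
  field_simp
  ring

/-! ### The line-of-sight probability -/

/-- Intersection means that a closed equation is solvable in the parameters `(s, u)`, and projecting
out the compact square is a closed map. This supplies all joint measurability of line-of-sight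
events. -/
lemma isClosed_not_disjoint_blockage :
    IsClosed {q : Plane × (ℝ × ℝ) × Plane × Plane |
      ¬ Disjoint (blockage q.1 q.2.1.1 q.2.1.2) (segment ℝ q.2.2.1 q.2.2.2)} := by
  have hd := continuous_dir
  have hK : IsClosed {p : (Set.Icc (0 : ℝ) 1 × Set.Icc (0 : ℝ) 1) × Plane × (ℝ × ℝ) × Plane × Plane |
      p.2.1 = p.2.2.2.1 - (p.2.2.1.1 / 2) • dir p.2.2.1.2 +
        ((p.1.1 : ℝ) • (p.2.2.2.2 - p.2.2.2.1) + (p.1.2 : ℝ) • (p.2.2.1.1 • dir p.2.2.1.2))} :=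
    isClosed_eq (by fun_prop) (by fun_prop)
  convert isClosedMap_snd_of_compactSpace _ hK using 1
  ext q
  simp only [Set.mem_ofPred_eq, not_disjoint_blockage_iff, Set.mem_image]
  constructor
  · rintro ⟨s, hs, u, hu, h⟩
    exact ⟨((⟨s, hs⟩, ⟨u, hu⟩), q), h, rfl⟩
  · rintro ⟨⟨⟨s, u⟩, q⟩, h, rfl⟩
    exact ⟨s, s.2, u, u.2, h⟩

lemma measurableSet_clear :
    MeasurableSet {p : BlockageField × Plane × Plane | Clear p.1 p.2.1 p.2.2} := by
  have : {p : BlockageField × Plane × Plane | Clear p.1 p.2.1 p.2.2} =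
      ⋂ n, ({p | Present p.1 n} ∩ {p | ¬ Disjoint (blockage (loc p.1 n) (mark p.1 n).1
        (mark p.1 n).2) (segment ℝ p.2.1 p.2.2)})ᶜ := by
    ext p
    simp [Clear]
  rw [this]
  refine MeasurableSet.iInter fun n => MeasurableSet.compl (MeasurableSet.inter ?_ ?_)
  · exact (measurable_fst.comp measurable_fst) (measurableSet_lt_size n)
  · have hm : Measurable fun p : BlockageField × Plane × Plane => (loc p.1 n, mark p.1 n, p.2) :=
      (((measurable_point n).comp measurable_fst).comp measurable_fst).prodMk
        ((((measurable_pi_apply n).comp measurable_snd).comp measurable_fst).prodMk measurable_snd)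
    exact hm isClosed_not_disjoint_blockage.measurableSet

lemma measurableSet_clear_left (a b : Plane) : MeasurableSet {f : BlockageField | Clear f a b} :=
  (measurable_id.prodMk measurable_const : Measurable fun f : BlockageField => (f, a, b))
    measurableSet_clear

lemma beta_pos {lamb Lmin Lmax : ℝ} (hb : 0 < lamb) (hL0 : 0 ≤ Lmin) (hL : Lmin < Lmax) :
    0 < beta lamb Lmin Lmax := by
  have : 0 < ∫ l, l ∂uniformLaw Lmin Lmax := by
    rw [integral_uniformLaw hL, integral_id]
    have h1 : 0 < Lmax - Lmin := by linarith
    have : 0 < Lmax ^ 2 - Lmin ^ 2 := by nlinarith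
    positivity
  unfold beta
  positivity

instance sigmaFinite_ofReal_smul_volume (lam : ℝ) :
    SigmaFinite (ENNReal.ofReal lam • (volume : Measure Plane)) :=
  inferInstanceAs (SigmaFinite (lam.toNNReal • (volume : Measure Plane)))

/-- The line-of-sight probability of a link. -/
lemma blockageLaw_clear {Qb : Measure (PointConfig Plane)} {lamb Lmin Lmax : ℝ}
    (hQb : IsHomogeneousPPP Qb lamb) (hb : 0 < lamb) (hL0 : 0 ≤ Lmin) (hL : Lmin < Lmax)
    (a b : Plane) :
    blockageLaw Qb Lmin Lmax {f | Clear f a b}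
      = ENNReal.ofReal (pLoS (beta lamb Lmin Lmax) ‖b - a‖) := by
  have := isProbabilityMeasure_uniformLaw hL
  set A : Set (Plane × ℝ × ℝ) :=
    {q | ¬ Disjoint (blockage q.1 q.2.1 q.2.2) (segment ℝ a b)}
  have hA : MeasurableSet A := by
    have hm : Measurable fun q : Plane × ℝ × ℝ => (q.1, q.2, a, b) := by fun_prop
    exact hm isClosed_not_disjoint_blockage.measurableSet
  have hset : {f : BlockageField | Clear f a b}
      = {c | ∀ n, Present c n → (loc c n, mark c n) ∉ A} := by
    ext f; simp [Clear, A]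
  have hI : ∫⁻ l, ENNReal.ofReal |l| ∂uniformLaw Lmin Lmax
      = ENNReal.ofReal (∫ l, l ∂uniformLaw Lmin Lmax) := by
    rw [lintegral_uniformLaw hL (Continuous.intervalIntegrable (by fun_prop) _ _)
      (fun _ _ => abs_nonneg _), integral_uniformLaw hL]
    congr 2
    refine intervalIntegral.integral_congr fun l hl => ?_
    rw [Set.uIcc_of_le hL.le] at hl
    exact abs_of_nonneg (hL0.trans hl.1)
  have hI0 : 0 ≤ ∫ l, l ∂uniformLaw Lmin Lmax := by
    have := (beta_pos (lamb := 1) one_pos hL0 hL).le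
    unfold beta at this
    by_contra hneg
    rw [not_le] at hneg
    have : 2 * 1 * (∫ l, l ∂uniformLaw Lmin Lmax) / Real.pi < 0 :=
      div_neg_of_neg_of_pos (by linarith) Real.pi_pos
    linarith
  rw [hset, blockageLaw, IsPoissonProcess.markedLaw_void hQb _ hA, Measure.prod_smul_left,
    Measure.smul_apply, Measure.prod_apply_symm hA, smul_eq_mul]
  -- Integrating over the midpoint first leaves the area of a parallelogram, which separates into a
  -- function of the length times one of the angle.
  have hsec : ∀ q : ℝ × ℝ, volume ((fun z => (z, q)) ⁻¹' A) = ENNReal.ofReal |q.1| *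
      ENNReal.ofReal |(b - a) 0 * Real.sin q.2 - (b - a) 1 * Real.cos q.2| := fun q =>
    volume_not_disjoint_blockage a b q.1 q.2
  simp only [hsec]
  rw [lintegral_prod_mul (f := fun l : ℝ => ENNReal.ofReal |l|)
    (g := fun θ => ENNReal.ofReal |(b - a) 0 * Real.sin θ - (b - a) 1 * Real.cos θ|)
    (Measurable.aemeasurable (by fun_prop)) (Measurable.aemeasurable (by fun_prop)), hI,
    lintegral_abs_cross_uniformLaw, ← ENNReal.ofReal_mul hI0, ← ENNReal.ofReal_mul hb.le,
    expNeg_ofReal (by positivity), pLoS, beta]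
  congr 3
  ring

/-! ### The probability of facing the reflecting side -/

lemma inner_smul_dir_risNormal (s a θ : ℝ) :
    inner ℝ (s • dir a) (risNormal θ) = s * Real.sin (a - θ) := by
  simp [dir, risNormal, PiLp.inner_apply, Fin.sum_univ_two, Real.sin_sub]
  ring

lemma inner_dir_dir (a b : ℝ) : inner ℝ (dir a) (dir b) = Real.cos (b - a) := by
  simp [dir, PiLp.inner_apply, Fin.sum_univ_two, Real.cos_sub]

lemma norm_dir (a : ℝ) : ‖dir a‖ = 1 := by
  have := real_inner_self_eq_norm_sq (dir a)
  rw [inner_dir_dir, sub_self, Real.cos_zero] at this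
  nlinarith [norm_nonneg (dir a)]

/-- On one period both sines are positive exactly on `(0, π) ∩ (-δ, π - δ)`. -/
lemma integral_sin_pos_and_sin_add_pos {δ : ℝ} (h1 : -Real.pi ≤ δ) (h2 : δ ≤ Real.pi) :
    ∫ s in (-Real.pi)..Real.pi,
      (if 0 < Real.sin s ∧ 0 < Real.sin (s + δ) then (1 : ℝ) else 0) = Real.pi - |δ| := by
  have hpi := Real.pi_pos
  have hset : ∀ s ∈ Set.Ioc (-Real.pi) Real.pi, (0 < Real.sin s ∧ 0 < Real.sin (s + δ)) ↔
      s ∈ Set.Ioo (max 0 (-δ)) (min Real.pi (Real.pi - δ)) := by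
    intro s hs
    rw [Set.mem_Ioo, max_lt_iff, lt_min_iff]
    constructor
    · rintro ⟨ha, hb⟩
      have hs0 : 0 < s := by
        by_contra h
        exact absurd (Real.sin_nonpos_of_nonpos_of_neg_pi_le (not_lt.1 h) hs.1.le) (not_le.2 ha)
      have hs1 : s < Real.pi := lt_of_le_of_ne hs.2 (by rintro rfl; simp at ha)
      refine ⟨⟨hs0, ?_⟩, hs1, ?_⟩
      · by_contra h
        exact absurd (Real.sin_nonpos_of_nonpos_of_neg_pi_le (by linarith) (by linarith))
          (not_le.2 hb)
      · by_contra h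
        have : Real.sin (s + δ) = - Real.sin (s + δ - Real.pi) := by
          rw [Real.sin_sub_pi, neg_neg]
        have h3 := Real.sin_nonneg_of_nonneg_of_le_pi (x := s + δ - Real.pi) (by linarith)
          (by linarith)
        linarith
    · rintro ⟨⟨h3, h4⟩, h5, h6⟩
      exact ⟨Real.sin_pos_of_pos_of_lt_pi h3 h5,
        Real.sin_pos_of_pos_of_lt_pi (by linarith) (by linarith)⟩
  rw [intervalIntegral.integral_of_le (by linarith)]
  have : ∫ s in Set.Ioc (-Real.pi) Real.pi,
      (if 0 < Real.sin s ∧ 0 < Real.sin (s + δ) then (1 : ℝ) else 0)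
      = ∫ s in Set.Ioc (-Real.pi) Real.pi,
        (Set.Ioo (max 0 (-δ)) (min Real.pi (Real.pi - δ))).indicator (fun _ => (1 : ℝ)) s := by
    refine setIntegral_congr_fun measurableSet_Ioc fun s hs => ?_
    simp only [hset s hs, Set.indicator_apply]
  rw [this, setIntegral_indicator measurableSet_Ioo, Set.inter_eq_right.2]
  · simp only [integral_const, smul_eq_mul, mul_one, measureReal_restrict_apply_univ]
    rcases le_total 0 δ with h | h
    · rw [abs_of_nonneg h, max_eq_left (by linarith), min_eq_right (by linarith),
        Real.volume_real_Ioo_of_le (by linarith)]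
      ring
    · rw [abs_of_nonpos h, max_eq_right (by linarith), min_eq_left (by linarith),
        Real.volume_real_Ioo_of_le (by linarith)]
  · intro s hs
    rw [Set.mem_Ioo, max_lt_iff, lt_min_iff] at hs
    exact ⟨by linarith [hs.1.1], hs.2.1.le⟩

/-- The normals on the positive side of a vector form a half circle; two half circles with axes at
angle `δ` overlap in an arc `π - |δ|` out of `2π`. -/
lemma uniformLaw_two_sided {u w : Plane} (hu : u ≠ 0) (hw : w ≠ 0) :
    uniformLaw 0 (2 * Real.pi) {θ | 0 < inner ℝ u (risNormal θ) ∧ 0 < inner ℝ w (risNormal θ)}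
      = ENNReal.ofReal (1 / 2 * (1 - 1 / Real.pi * InnerProductGeometry.angle u w)) := by
  obtain ⟨a, ha⟩ := exists_eq_smul_dir u
  obtain ⟨b, hb⟩ := exists_eq_smul_dir w
  have hu' := norm_pos_iff.2 hu
  have hw' := norm_pos_iff.2 hw
  -- The representative of the signed angle in `(-π, π]`, whose absolute value is the unsigned
  -- angle.
  set δ := ((b - a : ℝ) : Real.Angle).toReal with hδ
  have hcos : Real.cos δ = Real.cos (b - a) := by rw [hδ, Real.Angle.cos_toReal, Real.Angle.cos_coe]
  have hsin : Real.sin δ = Real.sin (b - a) := by rw [hδ, Real.Angle.sin_toReal, Real.Angle.sin_coe]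
  have hδ1 : -Real.pi ≤ δ := (Real.Angle.neg_pi_lt_toReal _).le
  have hδ2 : δ ≤ Real.pi := Real.Angle.toReal_le_pi _
  have hang : InnerProductGeometry.angle u w = |δ| := by
    rw [ha, hb, InnerProductGeometry.angle_smul_left_of_pos _ _ hu',
      InnerProductGeometry.angle_smul_right_of_pos _ _ hw', InnerProductGeometry.angle,
      norm_dir, norm_dir, inner_dir_dir, ← hcos, mul_one, div_one, ← Real.cos_abs,
      Real.arccos_cos (abs_nonneg _) (abs_le.2 ⟨hδ1, hδ2⟩)]
  set F : ℝ → ℝ := fun s => if 0 < Real.sin s ∧ 0 < Real.sin (s + δ) then 1 else 0 with hF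
  have hFm : Measurable F := by
    refine Measurable.ite (MeasurableSet.inter (s₁ := {s | 0 < Real.sin s})
      (s₂ := {s | 0 < Real.sin (s + δ)}) ?_ ?_) measurable_const measurable_const
    · exact measurableSet_lt measurable_const (by fun_prop)
    · exact measurableSet_lt measurable_const (by fun_prop)
  have hset : {θ | 0 < inner ℝ u (risNormal θ) ∧ 0 < inner ℝ w (risNormal θ)}
      = {θ | 0 < Real.sin (a - θ) ∧ 0 < Real.sin (a - θ + δ)} := by
    ext θ
    have : Real.sin (a - θ + δ) = Real.sin (b - θ) := by
      rw [Real.sin_add, hcos, hsin, ← Real.sin_add]; congr 1; ring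
    simp only [Set.mem_ofPred_eq, this]
    rw [ha, hb, inner_smul_dir_risNormal, inner_smul_dir_risNormal, mul_pos_iff_of_pos_left hu',
      mul_pos_iff_of_pos_left hw']
  have hmeas : MeasurableSet {θ | 0 < Real.sin (a - θ) ∧ 0 < Real.sin (a - θ + δ)} :=
    MeasurableSet.inter (s₁ := {θ | 0 < Real.sin (a - θ)})
      (s₂ := {θ | 0 < Real.sin (a - θ + δ)}) (measurableSet_lt measurable_const (by fun_prop))
      (measurableSet_lt measurable_const (by fun_prop))
  have hFb : ∀ s, ‖F s‖ ≤ 1 := by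
    intro s; simp only [hF]; split_ifs <;> simp
  have hper : Function.Periodic F (2 * Real.pi) := by
    intro s
    simp only [hF, Real.sin_add_two_pi, show s + 2 * Real.pi + δ = s + δ + 2 * Real.pi by ring]
  rw [hset, ← lintegral_indicator_one hmeas]
  have : ∀ θ, ({θ | 0 < Real.sin (a - θ) ∧ 0 < Real.sin (a - θ + δ)}.indicator 1 θ : ENNReal)
      = ENNReal.ofReal (F (a - θ)) := by
    intro θ
    simp only [hF, Set.indicator_apply, Set.mem_ofPred_eq, Pi.one_apply]
    split_ifs <;> simp
  simp only [this]
  have hshift : ∫ θ in (0 : ℝ)..(2 * Real.pi), F (a - θ) = ∫ s in (-Real.pi)..Real.pi, F s := by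
    have h := hper.intervalIntegral_add_eq (a - 2 * Real.pi) (-Real.pi)
    rw [sub_add_cancel, show -Real.pi + 2 * Real.pi = Real.pi by ring] at h
    rw [intervalIntegral.integral_comp_sub_left F a, sub_zero, h]
  rw [lintegral_uniformLaw Real.two_pi_pos, hshift,
    hF, integral_sin_pos_and_sin_add_pos hδ1 hδ2, hang]
  · congr 1
    have := Real.pi_pos
    field_simp
    simp
  · rw [intervalIntegrable_iff]
    refine Measure.integrableOn_of_bounded (M := 1) measure_Ioc_lt_top.ne ?_ ?_
    · exact (hFm.comp (measurable_const.sub measurable_id)).aestronglyMeasurable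
    · exact Eventually.of_forall fun θ => hFb _
  · intro θ _
    simp only [hF]; split_ifs <;> simp

/-! ### Polar coordinates in the plane -/

/-- Integration in polar coordinates. -/
lemma lintegral_plane_polar {F : Plane → ENNReal} (hF : Measurable F) :
    ∫⁻ z, F z = ∫⁻ φ in Set.Ioo (-Real.pi) Real.pi, ∫⁻ t in Set.Ioi (0 : ℝ),
      ENNReal.ofReal t * F (t • dir φ) := by
  have hd := continuous_dir.measurable
  have hmp : MeasurePreserving (fun p : ℝ × ℝ => (!₂[p.1, p.2] : Plane)) := by
    have h := (PiLp.volume_preserving_toLp (Fin 2)).comp (volume_preserving_finTwoArrow ℝ).symm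
    have he : (fun p : ℝ × ℝ => (!₂[p.1, p.2] : Plane))
        = WithLp.toLp 2 ∘ (MeasurableEquiv.finTwoArrow (α := ℝ)).symm := by
      funext p
      ext i
      fin_cases i <;> rfl
    rw [he]
    exact h
  rw [← hmp.lintegral_comp hF, ← lintegral_comp_polarCoord_symm, polarCoord_target,
    Measure.volume_eq_prod, setLIntegral_prod_symm]
  · refine lintegral_congr fun φ => lintegral_congr fun t => ?_
    have : (!₂[(polarCoord.symm (t, φ)).1, (polarCoord.symm (t, φ)).2] : Plane) = t • dir φ := by
      ext i
      fin_cases i <;> simp [dir, polarCoord_symm_apply]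
    rw [this, smul_eq_mul]
  · refine Measurable.aemeasurable ?_
    simp only [smul_eq_mul, polarCoord_symm_apply]
    fun_prop

lemma lintegral_plane_radial {F : ℝ → ENNReal} (hF : Measurable F) :
    ∫⁻ z : Plane, F ‖z‖
      = ENNReal.ofReal (2 * Real.pi) * ∫⁻ r in Set.Ioi (0 : ℝ), ENNReal.ofReal r * F r := by
  rw [lintegral_plane_polar (by fun_prop : Measurable fun z : Plane => F ‖z‖)]
  have : ∀ φ : ℝ, ∫⁻ t in Set.Ioi (0 : ℝ), ENNReal.ofReal t * F ‖t • dir φ‖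
      = ∫⁻ t in Set.Ioi (0 : ℝ), ENNReal.ofReal t * F t := by
    intro φ
    refine setLIntegral_congr_fun measurableSet_Ioi fun t ht => ?_
    simp only [norm_smul, norm_dir, mul_one, Real.norm_of_nonneg (le_of_lt ht)]
  simp only [this, lintegral_const, Measure.restrict_apply_univ, Real.volume_Ioo]
  rw [mul_comm]
  congr 2
  ring

lemma lintegral_exp_neg_norm_lt_top {b : ℝ} (hb : 0 < b) :
    ∫⁻ z : Plane, ENNReal.ofReal (Real.exp (-(b * ‖z‖))) < ⊤ := by
  rw [lintegral_plane_radial (F := fun r => ENNReal.ofReal (Real.exp (-(b * r)))) (by fun_prop)]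
  refine ENNReal.mul_lt_top ENNReal.ofReal_lt_top ?_
  have h := (integrableOn_rpow_mul_exp_neg_mul_rpow (p := 1) (s := 1) (by norm_num) one_pos
    hb).lintegral_lt_top
  refine lt_of_eq_of_lt (setLIntegral_congr_fun measurableSet_Ioi fun r hr => ?_) h
  simp only [Real.rpow_one, neg_mul, ENNReal.ofReal_mul (le_of_lt hr)]

/-- The reflection in the orthogonal complement of `v - w` swaps `v` and `w`. -/
lemma exists_linearIsometryEquiv {v w : Plane} (h : ‖v‖ = ‖w‖) :
    ∃ U : Plane ≃ₗᵢ[ℝ] Plane, U v = w :=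
  ⟨_, Submodule.reflection_sub h⟩

/-! ### Reflections inside an ellipse -/

/-- The probability that an RIS at `z` provides a reflected path between the origin and `y`. -/
noncomputable def reflWeight (β : ℝ) (y z : Plane) : ℝ :=
  1 / 2 * (1 - 1 / Real.pi * InnerProductGeometry.angle (0 - z) (y - z)) *
    (pLoS β ‖z‖ * pLoS β ‖y - z‖)

/-- The integral of `reflWeight` over the ellipse of the points whose distances to the
origin and to `y` have sum at most `X`. -/
noncomputable def ellipseMass (β : ℝ) (y : Plane) (X : ℝ) : ENNReal :=
  ∫⁻ z in {z : Plane | ‖z‖ + ‖y - z‖ ≤ X}, ENNReal.ofReal (reflWeight β y z)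

lemma measurable_pLoS (β : ℝ) : Measurable (pLoS β) := by
  unfold pLoS; fun_prop

lemma measurable_reflWeight (β : ℝ) (y : Plane) : Measurable (reflWeight β y) := by
  have := measurable_pLoS β
  have h := Real.continuous_arccos.measurable
  unfold reflWeight InnerProductGeometry.angle
  fun_prop

lemma half_one_sub_mem {x : ℝ} (h0 : 0 ≤ x) (h1 : x ≤ Real.pi) :
    0 ≤ 1 - 1 / Real.pi * x ∧ 1 - 1 / Real.pi * x ≤ 1 := by
  have hpi := Real.pi_pos
  have h2 : 1 / Real.pi * x ≤ 1 := by
    rw [one_div_mul_eq_div, div_le_one hpi]; exact h1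
  have h3 : 0 ≤ 1 / Real.pi * x := by positivity
  constructor <;> linarith

lemma measurableSet_ellipse (y : Plane) (X : ℝ) :
    MeasurableSet {z : Plane | ‖z‖ + ‖y - z‖ ≤ X} :=
  measurableSet_le (by fun_prop) measurable_const

/-- As `‖y‖ ≤ ‖z‖ + ‖y - z‖`, half of the exponent pays for the decay in `y`, and the other half
keeps decay in `z`. The bound is uniform in `X`, hence survives the sum over `k`, and is integrable
in `y`. -/
lemma ellipseMass_le {β : ℝ} (hβ : 0 < β) (y : Plane) (X : ℝ) :
    ellipseMass β y X ≤ ENNReal.ofReal (Real.exp (-(β / 2 * ‖y‖))) *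
      ∫⁻ z : Plane, ENNReal.ofReal (Real.exp (-(β / 2 * ‖z‖))) := by
  rw [← lintegral_const_mul _ (by fun_prop)]
  refine (setLIntegral_le_lintegral _ _).trans (lintegral_mono fun z => ?_)
  rw [← ENNReal.ofReal_mul (Real.exp_pos _).le]
  refine ENNReal.ofReal_le_ofReal ?_
  have h1 := half_one_sub_mem (InnerProductGeometry.angle_nonneg (0 - z) (y - z))
    (InnerProductGeometry.angle_le_pi _ _)
  have h2 : ‖y‖ ≤ ‖z‖ + ‖y - z‖ := by
    calc ‖y‖ = ‖z + (y - z)‖ := by congr 1; abel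
      _ ≤ _ := norm_add_le _ _
  have h3 : pLoS β ‖z‖ * pLoS β ‖y - z‖
      ≤ Real.exp (-(β / 2 * ‖y‖)) * Real.exp (-(β / 2 * ‖z‖)) := by
    rw [pLoS, pLoS, ← Real.exp_add, ← Real.exp_add, Real.exp_le_exp]
    nlinarith [norm_nonneg (y - z)]
  unfold reflWeight
  have h4 : 0 ≤ pLoS β ‖z‖ * pLoS β ‖y - z‖ := by unfold pLoS; positivity
  nlinarith [h1.1, h1.2]

lemma ellipseMass_lt_top {β : ℝ} (hβ : 0 < β) (y : Plane) (X : ℝ) : ellipseMass β y X < ⊤ :=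
  (ellipseMass_le hβ y X).trans_lt
    (ENNReal.mul_lt_top ENNReal.ofReal_lt_top (lintegral_exp_neg_norm_lt_top (half_pos hβ)))

/-- Isometries fixing the origin preserve distances and angles, so `y` may be moved to the positive
axis, where `reflProb` is expressed. -/
lemma ellipseMass_eq_of_norm_eq (β : ℝ) {y y' : Plane} (h : ‖y‖ = ‖y'‖) (X : ℝ) :
    ellipseMass β y X = ellipseMass β y' X := by
  obtain ⟨U, rfl⟩ := exists_linearIsometryEquiv h
  unfold ellipseMass
  rw [← lintegral_indicator (measurableSet_ellipse _ _),
    ← lintegral_indicator (measurableSet_ellipse _ _),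
    ← U.measurePreserving.lintegral_comp
      ((measurable_reflWeight β (U y)).ennreal_ofReal.indicator (measurableSet_ellipse (U y) X))]
  refine lintegral_congr fun z => ?_
  have hn : ‖U y - U z‖ = ‖y - z‖ := by rw [← map_sub, U.norm_map]
  have ha : InnerProductGeometry.angle (0 - U z) (U y - U z)
      = InnerProductGeometry.angle (0 - z) (y - z) := by
    rw [← map_sub, show (0 : Plane) - U z = U (0 - z) by rw [map_sub, map_zero]]
    exact U.toLinearIsometry.angle_map _ _
  simp only [Set.indicator_apply, Set.mem_ofPred_eq, U.norm_map, hn, reflWeight, ha]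

lemma norm_smul_dir_sub {r t φ : ℝ} :
    ‖r • dir 0 - t • dir φ‖ = √(r ^ 2 + t ^ 2 - 2 * r * t * Real.cos φ) := by
  rw [← Real.sqrt_sq (norm_nonneg _), norm_sub_sq_real, norm_smul, norm_smul, norm_dir, norm_dir,
    inner_smul_left, inner_smul_right, inner_dir_dir]
  simp only [mul_one, Real.norm_eq_abs, sq_abs, sub_zero, conj_trivial]
  congr 1; ring

lemma reflWeight_polar (β : ℝ) {r t : ℝ} (ht : 0 < t) (φ : ℝ) :
    reflWeight β (r • dir 0) (t • dir φ) = reflProb β r t φ := by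
  have hang : InnerProductGeometry.angle (0 - t • dir φ) (r • dir 0 - t • dir φ)
      = Real.arccos ((t - r * Real.cos φ) / √(t ^ 2 + r ^ 2 - 2 * r * t * Real.cos φ)) := by
    have hin : inner ℝ (0 - t • dir φ) (r • dir 0 - t • dir φ) = t * (t - r * Real.cos φ) := by
      rw [zero_sub, inner_neg_left, inner_sub_right, inner_smul_left, inner_smul_right,
        inner_smul_left, inner_smul_right, inner_dir_dir, inner_dir_dir]
      simp
      ring
    rw [InnerProductGeometry.angle, hin, norm_smul_dir_sub, zero_sub, norm_neg, norm_smul, norm_dir,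
      mul_one, Real.norm_of_nonneg ht.le, mul_div_mul_left _ _ ht.ne', add_comm (r ^ 2)]
  rw [reflWeight, hang, norm_smul_dir_sub, norm_smul, norm_dir, mul_one, Real.norm_of_nonneg ht.le,
    reflProb, reflC]
  ring

lemma reflProb_nonneg (β r t φ : ℝ) : 0 ≤ reflProb β r t φ := by
  have h := (half_one_sub_mem (Real.arccos_nonneg ((t - r * Real.cos φ) /
    √(t ^ 2 + r ^ 2 - 2 * r * t * Real.cos φ))) (Real.arccos_le_pi _)).1
  unfold reflProb pLoS reflC
  positivity

lemma measurable_reflProb (β r : ℝ) : Measurable fun p : ℝ × ℝ => reflProb β r p.2 p.1 := by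
  have h := Real.continuous_arccos.measurable
  unfold reflProb pLoS reflC
  fun_prop

/-- Squaring `√(r² + t² - 2rt cos φ) ≤ X - t` cancels `t²` and leaves a condition linear in `t`. -/
lemma mem_ellipse_polar {r t φ X : ℝ} (ht : 0 < t)
    (hφ : 0 < X - r * Real.cos φ) :
    ‖t • dir φ‖ + ‖r • dir 0 - t • dir φ‖ ≤ X
      ↔ t ≤ (X ^ 2 - r ^ 2) / (2 * (X - r * Real.cos φ)) := by
  rw [norm_smul_dir_sub, norm_smul, norm_dir, mul_one, Real.norm_of_nonneg ht.le, ← le_sub_iff_add_le',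
    le_div_iff₀ (by linarith)]
  constructor
  · intro h
    have h1 := (Real.sqrt_nonneg _).trans h
    have h2 := (Real.sqrt_le_left h1).1 h
    nlinarith
  · intro h
    refine (Real.sqrt_le_left ?_).2 ?_
    · have h1 : Real.cos φ ≤ 1 := Real.cos_le_one φ
      have h2 : -1 ≤ Real.cos φ := Real.neg_one_le_cos φ
      -- Undoing the square needs `t ≤ X`. Otherwise `X² - r² > 2X(X - r cos φ)`, that is `(X - r
      -- cos φ)² + (r sin φ)² < 0`.
      by_contra hneg
      rw [not_le] at hneg
      have h5 : t * (2 * (X - r * Real.cos φ)) > X * (2 * (X - r * Real.cos φ)) := by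
        apply mul_lt_mul_of_pos_right <;> linarith
      nlinarith [Real.sin_sq_add_cos_sq φ, sq_nonneg (X - r * Real.cos φ), sq_nonneg (Real.sin φ),
        sq_nonneg (r * Real.sin φ)]
    · nlinarith

/-- The mass of the ellipse as an iterated integral in polar coordinates. -/
lemma toReal_ellipseMass {β : ℝ} (hβ : 0 < β) {y : Plane} (hy : y ≠ 0) {X : ℝ} (hX : ‖y‖ ≤ X) :
    (ellipseMass β y X).toReal = ∫ φ in (-Real.pi)..Real.pi,
      ∫ t in (0 : ℝ)..((X ^ 2 - ‖y‖ ^ 2) / (2 * (X - ‖y‖ * Real.cos φ))),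
        reflProb β ‖y‖ t φ * t := by
  set r := ‖y‖ with hr
  have hr0 : 0 < r := norm_pos_iff.2 hy
  have hyr : ‖y‖ = ‖r • dir 0‖ := by rw [norm_smul, norm_dir, mul_one, Real.norm_of_nonneg hr0.le]
  have hmeas : Measurable fun z => {z : Plane | ‖z‖ + ‖r • dir 0 - z‖ ≤ X}.indicator
      (fun z => ENNReal.ofReal (reflWeight β (r • dir 0) z)) z :=
    (measurable_reflWeight β _).ennreal_ofReal.indicator (measurableSet_ellipse _ _)
  have hE : ellipseMass β y X = ∫⁻ z, {z : Plane | ‖z‖ + ‖r • dir 0 - z‖ ≤ X}.indicator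
      (fun z => ENNReal.ofReal (reflWeight β (r • dir 0) z)) z := by
    rw [ellipseMass_eq_of_norm_eq β hyr, ellipseMass, lintegral_indicator (measurableSet_ellipse _ _)]
  have hfin := ellipseMass_lt_top hβ y X
  rw [hE, lintegral_plane_polar hmeas] at hfin
  rw [hE, lintegral_plane_polar hmeas]
  set m : ℝ → ENNReal := fun φ => ∫⁻ t in Set.Ioi (0 : ℝ), ENNReal.ofReal t *
    {z : Plane | ‖z‖ + ‖r • dir 0 - z‖ ≤ X}.indicator
      (fun z => ENNReal.ofReal (reflWeight β (r • dir 0) z)) (t • dir φ) with hm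
  have hmm : Measurable m := by
    have hd := continuous_dir.measurable
    exact Measurable.lintegral_prod_right' (f := fun p : ℝ × ℝ => ENNReal.ofReal p.2 *
      {z : Plane | ‖z‖ + ‖r • dir 0 - z‖ ≤ X}.indicator
        (fun z => ENNReal.ofReal (reflWeight β (r • dir 0) z)) (p.2 • dir p.1))
      ((by fun_prop : Measurable fun p : ℝ × ℝ => ENNReal.ofReal p.2).mul
        (hmeas.comp (by fun_prop)))
  rw [← integral_toReal hmm.aemeasurable (ae_lt_top hmm hfin.ne),
    intervalIntegral.integral_of_le (by linarith [Real.pi_pos]), integral_Ioc_eq_integral_Ioo]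
  -- If `X = ‖y‖` the denominator `X - r cos φ` vanishes at `φ = 0`, a null direction.
  have hne : ∀ᵐ φ : ℝ, φ ≠ 0 := by simp [ae_iff]
  refine setIntegral_congr_ae measurableSet_Ioo ?_
  filter_upwards [hne] with φ hφ0 hφ
  have hcos : Real.cos φ < 1 := by
    refine lt_of_le_of_ne (Real.cos_le_one φ) fun h => hφ0 ?_
    exact (Real.cos_eq_one_iff_of_lt_of_lt (by linarith [hφ.1, Real.pi_pos])
      (by linarith [hφ.2, Real.pi_pos])).1 h
  have hden : 0 < X - r * Real.cos φ := by nlinarith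
  have hR : 0 ≤ (X ^ 2 - r ^ 2) / (2 * (X - r * Real.cos φ)) := by
    apply div_nonneg <;> nlinarith
  have hmφ : m φ = ∫⁻ t in Set.Ioc 0 ((X ^ 2 - r ^ 2) / (2 * (X - r * Real.cos φ))),
      ENNReal.ofReal (reflProb β r t φ * t) := by
    simp only [hm]
    rw [← lintegral_indicator measurableSet_Ioi, ← lintegral_indicator measurableSet_Ioc]
    refine lintegral_congr fun t => ?_
    simp only [Set.indicator_apply, Set.mem_Ioi, Set.mem_Ioc, Set.mem_ofPred_eq]
    by_cases ht : 0 < t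
    · simp only [ht, mem_ellipse_polar ht hden, if_true, true_and, reflWeight_polar β ht]
      split_ifs
      · rw [ENNReal.ofReal_mul (reflProb_nonneg _ _ _ _), mul_comm]
      · simp
    · simp [ht]
  rw [hmφ, intervalIntegral.integral_of_le hR, integral_eq_lintegral_of_nonneg_ae]
  · exact (ae_restrict_iff' measurableSet_Ioc).2
      (Eventually.of_forall fun t ht => mul_nonneg (reflProb_nonneg _ _ _ _) ht.1.le)
  · have h := (measurable_reflProb β r).comp (measurable_prodMk_left (x := φ))
    exact (Measurable.mul h measurable_id).aestronglyMeasurable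

lemma ellipseMass_eq_zero (β : ℝ) {y : Plane} {X : ℝ} (hX : X < ‖y‖) : ellipseMass β y X = 0 := by
  have : {z : Plane | ‖z‖ + ‖y - z‖ ≤ X} = ∅ := by
    ext z
    simp only [Set.mem_ofPred_eq, Set.mem_empty_iff_false, iff_false, not_le]
    calc X < ‖y‖ := hX
      _ = ‖z + (y - z)‖ := by congr 1; abel
      _ ≤ _ := norm_add_le _ _
  rw [ellipseMass, this]; simp

/-- The complementary distribution function of the shortest path via an RIS. -/
lemma one_sub_cdfRik {β : ℝ} (hβ : 0 < β) (lamk : ℝ) {y : Plane} (hy : y ≠ 0) (X : ℝ) :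
    1 - cdfRik β lamk ‖y‖ X = Real.exp (-(lamk * (ellipseMass β y X).toReal)) := by
  unfold cdfRik
  split_ifs with h
  · simp [ellipseMass_eq_zero β h]
  · rw [toReal_ellipseMass hβ hy (not_lt.1 h)]
    ring

/-! ### Path losses -/

/-- In `ENNReal` the case `D = 0` needs no separate treatment: `0 ^ (-α) = ∞`, so the loss is `0`.
-/
lemma inv_mul_rpow_neg_le_iff {α τ c D : ℝ} (hα : 0 < α) (hτ : 0 ≤ τ) (hc : 0 < c) (hD : 0 ≤ D) :
    (ENNReal.ofReal c * ENNReal.ofReal D ^ (-α))⁻¹ ≤ ENNReal.ofReal τ ↔ D ≤ (c * τ) ^ (1 / α) := by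
  have hc0 : ENNReal.ofReal c ≠ 0 := (ENNReal.ofReal_pos.2 hc).ne'
  rw [ENNReal.mul_inv (Or.inl hc0) (Or.inl ENNReal.ofReal_ne_top), ENNReal.rpow_neg, inv_inv,
    ENNReal.inv_mul_le_iff hc0 ENNReal.ofReal_ne_top, ← ENNReal.ofReal_mul hc.le,
    ENNReal.ofReal_rpow_of_nonneg hD hα.le,
    ENNReal.ofReal_le_ofReal_iff (mul_nonneg hc.le hτ), one_div,
    Real.le_rpow_inv_iff_of_pos hD (mul_nonneg hc.le hτ) hα]

lemma measurable_losInd :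
    Measurable fun p : BlockageField × Plane × Plane => losInd p.1 p.2.1 p.2.2 := by
  unfold losInd
  exact Measurable.ite measurableSet_clear measurable_const measurable_const

lemma measurableSet_facing : MeasurableSet {p : Plane × ℝ × Plane |
    0 < inner ℝ (0 - p.1) (risNormal p.2.1) ∧ 0 < inner ℝ (p.2.2 - p.1) (risNormal p.2.1)} := by
  have hd := continuous_risNormal
  exact ((isOpen_lt continuous_const (by fun_prop : Continuous fun p : Plane × ℝ × Plane =>
      (inner ℝ (0 - p.1) (risNormal p.2.1) : ℝ))).inter
    (isOpen_lt continuous_const (by fun_prop : Continuous fun p : Plane × ℝ × Plane =>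
      (inner ℝ (p.2.2 - p.1) (risNormal p.2.1) : ℝ)))).measurableSet

lemma measurable_facing :
    Measurable fun p : Plane × ℝ × Plane => facing p.1 p.2.1 p.2.2 := by
  unfold facing
  exact Measurable.ite measurableSet_facing measurable_const measurable_const

open Classical in
/-- The path-loss provided by a single RIS to the base station at `y` when the direct link is
obstructed; an RIS whose number of meta-surfaces is not in the support of `ρ` is discarded. -/
noncomputable def risScore (α : ℝ) (ρ : PMF ℕ) (y : Plane) (p : Plane × RISMark) : ENNReal :=
  if p.2.1 ∈ ρ.support then
    ((p.2.1 : ENNReal) ^ 2 * (losInd p.2.2.2.1 0 p.1 * losInd p.2.2.2.2 p.1 y *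
      facing p.1 p.2.2.1 y * ENNReal.ofReal (‖p.1‖ + ‖y - p.1‖) ^ (-α)))⁻¹
  else ⊤

lemma measurable_risScore (α : ℝ) (ρ : PMF ℕ) :
    Measurable fun q : Plane × Plane × RISMark => risScore α ρ q.1 q.2 := by
  unfold risScore
  have h1 := measurable_losInd.comp (by fun_prop :
    Measurable fun q : Plane × Plane × RISMark => (q.2.2.2.2.1, (0 : Plane), q.2.1))
  have h2 := measurable_losInd.comp (by fun_prop :
    Measurable fun q : Plane × Plane × RISMark => (q.2.2.2.2.2, q.2.1, q.1))
  have h3 := measurable_facing.comp (by fun_prop :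
    Measurable fun q : Plane × Plane × RISMark => (q.2.1, q.2.2.2.1, q.1))
  have h4 : Measurable fun q : Plane × Plane × RISMark =>
      ENNReal.ofReal (‖q.2.1‖ + ‖q.1 - q.2.1‖) ^ (-α) := by fun_prop
  have hk : Measurable fun q : Plane × Plane × RISMark => q.2.2.1 := by fun_prop
  have h5 : Measurable fun q : Plane × Plane × RISMark => (q.2.2.1 : ENNReal) ^ 2 :=
    (measurable_from_top (f := fun k : ℕ => (k : ENNReal) ^ 2)).comp hk
  refine Measurable.ite (hk (MeasurableSet.of_discrete (s := ρ.support))) ?_ measurable_const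
  exact (h5.mul (((h1.mul h2).mul h3).mul h4)).inv

lemma iInf_indirectPathLoss_of_clear (α : ℝ) (ρ : PMF ℕ) {f : BlockageField} (R : RISField)
    {y : Plane} (h : Clear f 0 y) :
    ⨅ k ∈ ρ.support, indirectPathLoss α f R k y = ⊤ := by
  simp [indirectPathLoss, losInd, h]

/-- Merging the infima over `k` and over the RISs with `k` surfaces gives a best score of one marked
Poisson process, to which `markedLaw_iInf_le` applies. -/
lemma iInf_indirectPathLoss_of_not_clear (α : ℝ) (ρ : PMF ℕ) {f : BlockageField} (R : RISField)
    {y : Plane} (h : ¬ Clear f 0 y) :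
    ⨅ k ∈ ρ.support, indirectPathLoss α f R k y
      = ⨅ (n : ℕ) (_ : Present R n), risScore α ρ y (loc R n, mark R n) := by
  have h1 : 1 - losInd f 0 y = 1 := by simp [losInd, h]
  simp only [indirectPathLoss, h1, mul_one, ENNReal.mul_iSup, ENNReal.inv_iSup]
  refine le_antisymm (le_iInf₂ fun n hn => ?_) (le_iInf₂ fun k hk => le_iInf₂ fun n hn =>
    le_iInf fun hnk => ?_)
  · unfold risScore
    split_ifs with hs
    · exact iInf₂_le_of_le _ hs (iInf₂_le_of_le n hn (iInf_le_of_le rfl le_rfl))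
    · exact le_top
  · refine iInf₂_le_of_le n hn ?_
    subst hnk
    simp only [risScore, hk, if_true, le_refl]

/-- Since `ρ 0 = 0`, the factor `k²` is positive and rescales the threshold to `(k² τ)^(1/α)`; this
is where `x * k^(2/α)` in `funH` comes from. -/
lemma risScore_le_iff {α τ : ℝ} (hα : 0 < α) (hτ : 0 ≤ τ) {ρ : PMF ℕ} (hρ : ρ 0 = 0)
    (y z : Plane) (k : ℕ) (θ : ℝ) (f g : BlockageField) :
    risScore α ρ y (z, k, θ, f, g) ≤ ENNReal.ofReal τ ↔
      k ∈ ρ.support ∧ ‖z‖ + ‖y - z‖ ≤ τ ^ (1 / α) * (k : ℝ) ^ (2 / α) ∧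
        (0 < inner ℝ (0 - z) (risNormal θ) ∧ 0 < inner ℝ (y - z) (risNormal θ)) ∧
          Clear f 0 z ∧ Clear g z y := by
  by_cases hk : k ∈ ρ.support
  swap
  · simp [risScore, hk]
  have hk0 : 0 < (k : ℝ) := by
    rw [Nat.cast_pos, Nat.pos_iff_ne_zero]
    rintro rfl
    exact (PMF.mem_support_iff _ _).1 hk hρ
  have hX : ((k : ℝ) ^ 2 * τ) ^ (1 / α) = τ ^ (1 / α) * (k : ℝ) ^ (2 / α) := by
    rw [Real.mul_rpow (by positivity) hτ, mul_comm, ← Real.rpow_natCast, ← Real.rpow_mul hk0.le]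
    congr 2
    push_cast
    ring
  simp only [risScore, hk, if_true, true_and]
  by_cases h1 : Clear f 0 z
  swap
  · simp [losInd, h1]
  by_cases h2 : Clear g z y
  swap
  · simp [losInd, h2]
  by_cases h3 : 0 < inner ℝ (0 - z) (risNormal θ) ∧ 0 < inner ℝ (y - z) (risNormal θ)
  swap
  · have hf : facing z θ y = 0 := if_neg h3
    rw [hf]
    simp only [h3, false_and, and_false, iff_false]
    simp
  have hf : facing z θ y = 1 := if_pos h3
  have hl1 : losInd f 0 z = 1 := if_pos h1
  have hl2 : losInd g z y = 1 := if_pos h2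
  have hc : (k : ENNReal) ^ 2 = ENNReal.ofReal ((k : ℝ) ^ 2) := by
    rw [ENNReal.ofReal_pow hk0.le, ENNReal.ofReal_natCast]
  rw [hf, hl1, hl2, one_mul, one_mul, one_mul, hc,
    inv_mul_rpow_neg_le_iff hα hτ (by positivity) (by positivity), hX]
  simp only [h1, h2, h3, and_true]

/-! ### The law of the best reflected path -/

lemma isProbabilityMeasure_blockageLaw {Qb : Measure (PointConfig Plane)} {lamb Lmin Lmax : ℝ}
    (hQb : IsHomogeneousPPP Qb lamb) (hL : Lmin < Lmax) :
    IsProbabilityMeasure (blockageLaw Qb Lmin Lmax) := by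
  have := isProbabilityMeasure_uniformLaw hL
  have := hQb.isProbabilityMeasure
  unfold blockageLaw
  infer_instance

lemma isProbabilityMeasure_risLaw {QR : Measure (PointConfig Plane)} {lamR : ℝ}
    (hQR : IsHomogeneousPPP QR lamR) (ρ : PMF ℕ) (B : Measure BlockageField)
    [IsProbabilityMeasure B] : IsProbabilityMeasure (risLaw QR ρ B) := by
  have := hQR.isProbabilityMeasure
  unfold risLaw
  infer_instance

/-- The intensity of the RISs providing a path-loss of at most `t` to the base station at `y`. -/
noncomputable def risIntensity (lamR α : ℝ) (ρ : PMF ℕ) (B : Measure BlockageField)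
    (y : Plane) (t : ENNReal) : ENNReal :=
  ((ENNReal.ofReal lamR • (volume : Measure Plane)).prod
    (ρ.toMeasure.prod ((uniformLaw 0 (2 * Real.pi)).prod (B.prod B)))) {p | risScore α ρ y p ≤ t}

section RIS

variable {B : Measure BlockageField} [IsProbabilityMeasure B] {β lamR α τ : ℝ} {ρ : PMF ℕ}

/-- For fixed location and `k`, orientation and the two blockage fields are independent, so their
probabilities multiply to `reflWeight`. At `z = 0` or `z = y` the facing probability differs; these
locations are null in `risIntensity_eq`. -/
lemma markLaw_section (hB : ∀ a b, B {f | Clear f a b} = ENNReal.ofReal (pLoS β ‖b - a‖))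
    (hα : 0 < α) (hτ : 0 ≤ τ) (hρ : ρ 0 = 0) {y z : Plane} (hz : z ≠ 0) (hzy : z ≠ y) :
    (ρ.toMeasure.prod ((uniformLaw 0 (2 * Real.pi)).prod (B.prod B)))
        (Prod.mk z ⁻¹' {p | risScore α ρ y p ≤ ENNReal.ofReal τ})
      = ∑' k : ℕ, ρ k * {z : Plane | ‖z‖ + ‖y - z‖ ≤ τ ^ (1 / α) * (k : ℝ) ^ (2 / α)}.indicator
          (fun z => ENNReal.ofReal (reflWeight β y z)) z := by
  have hmeas : MeasurableSet {p | risScore α ρ y p ≤ ENNReal.ofReal τ} :=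
    measurableSet_le ((measurable_risScore α ρ).comp measurable_prodMk_left) measurable_const
  rw [Measure.prod_apply (measurable_prodMk_left hmeas), lintegral_countable']
  refine tsum_congr fun k => ?_
  rw [PMF.toMeasure_apply_singleton _ _ (measurableSet_singleton k), mul_comm]
  by_cases hk : k ∈ ρ.support
  swap
  · rw [PMF.mem_support_iff, not_not] at hk
    simp [hk]
  congr 1
  rw [Set.indicator_apply]
  split_ifs with hD
  · have hset : Prod.mk k ⁻¹' (Prod.mk z ⁻¹' {p | risScore α ρ y p ≤ ENNReal.ofReal τ})
        = {θ | 0 < inner ℝ (0 - z) (risNormal θ) ∧ 0 < inner ℝ (y - z) (risNormal θ)} ×ˢ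
          ({f | Clear f 0 z} ×ˢ {g | Clear g z y}) := by
      ext ⟨θ, f, g⟩
      simp only [Set.mem_preimage, Set.mem_ofPred_eq, risScore_le_iff hα hτ hρ, hk, true_and,
        Set.mem_prod]
      rw [Set.mem_ofPred_eq] at hD
      simp only [hD, true_and]
    rw [hset, Measure.prod_prod, Measure.prod_prod, hB, hB,
      uniformLaw_two_sided (sub_ne_zero.2 hz.symm) (sub_ne_zero.2 hzy.symm), sub_zero,
      ← ENNReal.ofReal_mul (by unfold pLoS; positivity), ← ENNReal.ofReal_mul, reflWeight]
    have := (half_one_sub_mem (InnerProductGeometry.angle_nonneg (0 - z) (y - z))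
      (InnerProductGeometry.angle_le_pi _ _)).1
    positivity
  · have hset : Prod.mk k ⁻¹' (Prod.mk z ⁻¹' {p | risScore α ρ y p ≤ ENNReal.ofReal τ}) = ∅ := by
      ext ⟨θ, f, g⟩
      simp only [Set.mem_preimage, Set.mem_ofPred_eq, risScore_le_iff hα hτ hρ,
        Set.mem_empty_iff_false, iff_false]
      exact fun h => hD h.2.1
    rw [hset, measure_empty]

lemma risIntensity_eq (hB : ∀ a b, B {f | Clear f a b} = ENNReal.ofReal (pLoS β ‖b - a‖))
    (hα : 0 < α) (hτ : 0 ≤ τ) (hρ : ρ 0 = 0) (y : Plane) :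
    risIntensity lamR α ρ B y (ENNReal.ofReal τ)
      = ∑' k : ℕ, ENNReal.ofReal lamR * ρ k *
          ellipseMass β y (τ ^ (1 / α) * (k : ℝ) ^ (2 / α)) := by
  have hmeas : MeasurableSet {p | risScore α ρ y p ≤ ENNReal.ofReal τ} :=
    measurableSet_le ((measurable_risScore α ρ).comp measurable_prodMk_left) measurable_const
  have hind : ∀ k : ℕ, Measurable fun z : Plane =>
      {z : Plane | ‖z‖ + ‖y - z‖ ≤ τ ^ (1 / α) * (k : ℝ) ^ (2 / α)}.indicator
          (fun z => ENNReal.ofReal (reflWeight β y z)) z := fun k =>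
    (measurable_reflWeight β y).ennreal_ofReal.indicator (measurableSet_ellipse _ _)
  rw [risIntensity, Measure.prod_smul_left, Measure.smul_apply, Measure.prod_apply hmeas,
    smul_eq_mul]
  have hne : ∀ x : Plane, ∀ᵐ z : Plane, z ≠ x := fun x => by simp [ae_iff]
  have hae : ∀ᵐ z : Plane, (ρ.toMeasure.prod ((uniformLaw 0 (2 * Real.pi)).prod (B.prod B)))
        (Prod.mk z ⁻¹' {p | risScore α ρ y p ≤ ENNReal.ofReal τ})
      = ∑' k : ℕ, ρ k * {z : Plane | ‖z‖ + ‖y - z‖ ≤ τ ^ (1 / α) * (k : ℝ) ^ (2 / α)}.indicator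
          (fun z => ENNReal.ofReal (reflWeight β y z)) z := by
    filter_upwards [hne 0, hne y] with z hz hzy
    exact markLaw_section hB hα hτ hρ hz hzy
  rw [lintegral_congr_ae hae, lintegral_tsum fun k => ((hind k).const_mul _).aemeasurable,
    ← ENNReal.tsum_mul_left]
  refine tsum_congr fun k => ?_
  rw [lintegral_const_mul _ (hind k), lintegral_indicator (measurableSet_ellipse _ _), ellipseMass,
    mul_assoc]

lemma risIntensity_le (hβ : 0 < β)
    (hB : ∀ a b, B {f | Clear f a b} = ENNReal.ofReal (pLoS β ‖b - a‖))
    (hα : 0 < α) (hτ : 0 ≤ τ) (hρ : ρ 0 = 0) (y : Plane) :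
    risIntensity lamR α ρ B y (ENNReal.ofReal τ)
      ≤ ENNReal.ofReal lamR * (ENNReal.ofReal (Real.exp (-(β / 2 * ‖y‖))) *
      ∫⁻ z : Plane, ENNReal.ofReal (Real.exp (-(β / 2 * ‖z‖)))) := by
  rw [risIntensity_eq hB hα hτ hρ]
  refine (ENNReal.tsum_le_tsum fun k => mul_le_mul_right (ellipseMass_le hβ y _) _).trans ?_
  rw [ENNReal.tsum_mul_right, ENNReal.tsum_mul_left, ρ.tsum_coe, mul_one]

lemma risIntensity_lt_top (hβ : 0 < β)
    (hB : ∀ a b, B {f | Clear f a b} = ENNReal.ofReal (pLoS β ‖b - a‖))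
    (hα : 0 < α) (hτ : 0 ≤ τ) (hρ : ρ 0 = 0) (y : Plane) :
    risIntensity lamR α ρ B y (ENNReal.ofReal τ) < ⊤ :=
  (risIntensity_le hβ hB hα hτ hρ y).trans_lt (ENNReal.mul_lt_top ENNReal.ofReal_lt_top
    (ENNReal.mul_lt_top ENNReal.ofReal_lt_top (lintegral_exp_neg_norm_lt_top (half_pos hβ))))

/-- The probability that no RIS provides a path-loss of at most `τ`, as a product of complementary
distribution functions. -/
lemma exp_neg_toReal_risIntensity (hβ : 0 < β) (hR : 0 ≤ lamR)
    (hB : ∀ a b, B {f | Clear f a b} = ENNReal.ofReal (pLoS β ‖b - a‖))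
    (hα : 0 < α) (hτ : 0 ≤ τ) (hρ : ρ 0 = 0) {y : Plane} (hy : y ≠ 0) :
    Real.exp (-(risIntensity lamR α ρ B y (ENNReal.ofReal τ)).toReal)
      = ∏' k : ρ.support, (1 - cdfRik β (lamR * (ρ k).toReal) ‖y‖
          (τ ^ (1 / α) * ((k : ℕ) : ℝ) ^ (2 / α))) := by
  have hlt := risIntensity_lt_top (lamR := lamR) hβ hB hα hτ hρ y
  rw [risIntensity_eq hB hα hτ hρ] at hlt ⊢
  set F : ℕ → ENNReal := fun k => ENNReal.ofReal lamR * ρ k *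
    ellipseMass β y (τ ^ (1 / α) * (k : ℝ) ^ (2 / α)) with hF
  have hsub : ∑' k : ρ.support, F k = ∑' k, F k := by
    refine tsum_subtype_eq_of_support_subset fun k hk => ?_
    rw [PMF.mem_support_iff]
    intro h0
    exact hk (by simp [hF, h0])
  rw [← hsub] at hlt ⊢
  have hne : ∀ k : ρ.support, F k ≠ ⊤ := fun k => ENNReal.ne_top_of_tsum_ne_top hlt.ne k
  -- The support may be infinite; finite total intensity makes the real series summable, so its
  -- exponential is a convergent product.
  have hs : HasSum (fun k : ρ.support => -(F k).toReal) (-(∑' k : ρ.support, F k).toReal) := by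
    rw [ENNReal.tsum_toReal_eq hne]
    exact (ENNReal.summable_toReal hlt.ne).hasSum.neg
  rw [← hs.rexp.tprod_eq]
  refine tprod_congr fun k => ?_
  rw [one_sub_cdfRik hβ _ hy]
  simp only [Function.comp_apply, hF, ENNReal.toReal_mul, ENNReal.toReal_ofReal hR]

lemma risLaw_iInf_le {QR : Measure (PointConfig Plane)} (hQR : IsHomogeneousPPP QR lamR)
    (hβ : 0 < β) (hB : ∀ a b, B {f | Clear f a b} = ENNReal.ofReal (pLoS β ‖b - a‖))
    (hα : 0 < α) (hτ : 0 ≤ τ) (hρ : ρ 0 = 0) (y : Plane) :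
    risLaw QR ρ B {R | ⨅ (n : ℕ) (_ : Present R n), risScore α ρ y (loc R n, mark R n)
        ≤ ENNReal.ofReal τ}
      = 1 - expNeg (risIntensity lamR α ρ B y (ENNReal.ofReal τ)) := by
  refine IsPoissonProcess.markedLaw_iInf_le hQR _
    ((measurable_risScore α ρ).comp measurable_prodMk_left)
    -- Any larger threshold would do, the intensity being finite at each.
    (t' := ENNReal.ofReal (τ + 1)) ?_ ?_
  · exact (ENNReal.ofReal_lt_ofReal_iff (by linarith)).2 (by linarith)
  · exact (risIntensity_lt_top hβ hB hα (by linarith) hρ y).ne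

end RIS

/-! ### The path-loss of a single base station -/

/-- The path-loss of a base station as a function of its location and its mark. -/
noncomputable def netScore (α : ℝ) (ρ : PMF ℕ) (p : Plane × BlockageField × RISField) : ENNReal :=
  min (directPathLoss α p.2.1 p.1) (⨅ k ∈ ρ.support, indirectPathLoss α p.2.1 p.2.2 k p.1)

open Classical in
/-- The distance of a base station that is in direct line of sight, `∞` for the others. -/
noncomputable def losScore (p : Plane × BlockageField × RISField) : ENNReal :=
  if Clear p.2.1 0 p.1 then ENNReal.ofReal ‖p.1‖ else ⊤

lemma measurableSet_clear_network :
    MeasurableSet {p : Plane × BlockageField × RISField | Clear p.2.1 0 p.1} :=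
  (by fun_prop : Measurable fun p : Plane × BlockageField × RISField => (p.2.1, (0 : Plane), p.1))
    measurableSet_clear

lemma measurable_losScore : Measurable losScore := by
  unfold losScore
  exact Measurable.ite measurableSet_clear_network (by fun_prop) measurable_const

lemma measurable_iInf_risScore (α : ℝ) (ρ : PMF ℕ) :
    Measurable fun p : Plane × RISField =>
      ⨅ (n : ℕ) (_ : Present p.2 n), risScore α ρ p.1 (loc p.2 n, mark p.2 n) := by
  classical
  simp only [iInf_eq_if]
  refine Measurable.iInf fun n => Measurable.ite ?_ ?_ measurable_const
  · exact (measurable_fst.comp measurable_snd) (measurableSet_lt_size n)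
  · have hm : Measurable fun p : Plane × RISField => (p.1, loc p.2 n, mark p.2 n) :=
      measurable_fst.prodMk ((((measurable_point n).comp measurable_fst).comp
        measurable_snd).prodMk (((measurable_pi_apply n).comp measurable_snd).comp measurable_snd))
    exact (measurable_risScore α ρ).comp hm

lemma measurable_netScore (α : ℝ) (ρ : PMF ℕ) : Measurable (netScore α ρ) := by
  classical
  have h : netScore α ρ = fun p => min (directPathLoss α p.2.1 p.1)
      (if Clear p.2.1 0 p.1 then ⊤ else
        ⨅ (n : ℕ) (_ : Present p.2.2 n), risScore α ρ p.1 (loc p.2.2 n, mark p.2.2 n)) := by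
    funext p
    rw [netScore]
    split_ifs with hc
    · rw [iInf_indirectPathLoss_of_clear α ρ _ hc]
    · rw [iInf_indirectPathLoss_of_not_clear α ρ _ hc]
  rw [h]
  have h1 := measurable_losInd.comp (by fun_prop :
    Measurable fun p : Plane × BlockageField × RISField => (p.2.1, (0 : Plane), p.1))
  have h2 : Measurable fun p : Plane × BlockageField × RISField =>
      ENNReal.ofReal ‖p.1‖ ^ (-α) := by fun_prop
  have h3 : Measurable fun p : Plane × BlockageField × RISField => directPathLoss α p.2.1 p.1 := by
    unfold directPathLoss
    exact (h1.mul h2).inv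
  have h4 : Measurable fun p : Plane × BlockageField × RISField => (p.1, p.2.2) := by fun_prop
  have h5 := (measurable_iInf_risScore α ρ).comp h4
  exact Measurable.min h3 (Measurable.ite measurableSet_clear_network measurable_const h5)

lemma directPathLoss_le_iff {α τ : ℝ} (hα : 0 < α) (hτ : 0 ≤ τ) (f : BlockageField) (y : Plane) :
    directPathLoss α f y ≤ ENNReal.ofReal τ ↔ Clear f 0 y ∧ ‖y‖ ≤ τ ^ (1 / α) := by
  by_cases h : Clear f 0 y
  · have := inv_mul_rpow_neg_le_iff hα hτ one_pos (norm_nonneg y)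
    rw [ENNReal.ofReal_one, one_mul τ] at this
    simp only [directPathLoss, losInd, h, if_true, this, true_and]
  · simp [directPathLoss, losInd, h]

lemma losScore_le_iff {x : ℝ} (hx : 0 ≤ x) (p : Plane × BlockageField × RISField) :
    losScore p ≤ ENNReal.ofReal x ↔ Clear p.2.1 0 p.1 ∧ ‖p.1‖ ≤ x := by
  by_cases h : Clear p.2.1 0 p.1
  · simp only [losScore, h, if_true, ENNReal.ofReal_le_ofReal_iff hx, true_and]
  · simp [losScore, h]

section Mark

variable {B : Measure BlockageField} {C : Measure RISField} [IsProbabilityMeasure C] {β α τ : ℝ}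

lemma markLaw_losScore_le (hB : ∀ a b, B {f | Clear f a b} = ENNReal.ofReal (pLoS β ‖b - a‖))
    {x : ℝ} (hx : 0 ≤ x) (y : Plane) :
    (B.prod C) (Prod.mk y ⁻¹' {p | losScore p ≤ ENNReal.ofReal x})
      = if ‖y‖ ≤ x then ENNReal.ofReal (pLoS β ‖y‖) else 0 := by
  split_ifs with h
  · have : Prod.mk y ⁻¹' {p | losScore p ≤ ENNReal.ofReal x}
        = {f | Clear f 0 y} ×ˢ (Set.univ : Set RISField) := by
      ext ⟨f, R⟩
      simp [losScore_le_iff hx, h]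
    rw [this, Measure.prod_prod, measure_univ, mul_one, hB, sub_zero]
  · have : Prod.mk y ⁻¹' {p | losScore p ≤ ENNReal.ofReal x} = ∅ := by
      ext ⟨f, R⟩
      simp only [Set.mem_preimage, Set.mem_ofPred_eq, losScore_le_iff hx,
        Set.mem_empty_iff_false, iff_false]
      exact fun hh => h hh.2
    rw [this, measure_empty]

/-- A clear direct link makes every indirect loss infinite and a blocked one makes the direct loss
infinite. The event is thus a disjoint union, whose second piece is a product by independence of the
link and the RIS field. -/
lemma markLaw_netScore_le [IsProbabilityMeasure B]
    (hB : ∀ a b, B {f | Clear f a b} = ENNReal.ofReal (pLoS β ‖b - a‖))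
    (hα : 0 < α) (hτ : 0 ≤ τ) (ρ : PMF ℕ) (y : Plane) :
    (B.prod C) (Prod.mk y ⁻¹' {p | netScore α ρ p ≤ ENNReal.ofReal τ})
      = (if ‖y‖ ≤ τ ^ (1 / α) then ENNReal.ofReal (pLoS β ‖y‖) else 0) +
        ENNReal.ofReal (1 - pLoS β ‖y‖) * C {R | ⨅ (n : ℕ) (_ : Present R n),
          risScore α ρ y (loc R n, mark R n) ≤ ENNReal.ofReal τ} := by
  set E := {R : RISField | ⨅ (n : ℕ) (_ : Present R n),
          risScore α ρ y (loc R n, mark R n) ≤ ENNReal.ofReal τ} with hE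
  have hEm : MeasurableSet E :=
    measurableSet_le ((measurable_iInf_risScore α ρ).comp measurable_prodMk_left) measurable_const
  have hcl := measurableSet_clear_left 0 y
  have hset : Prod.mk y ⁻¹' {p | netScore α ρ p ≤ ENNReal.ofReal τ}
      = (Prod.mk y ⁻¹' {p | losScore p ≤ ENNReal.ofReal (τ ^ (1 / α))}) ∪
        {f | Clear f 0 y}ᶜ ×ˢ E := by
    ext ⟨f, R⟩
    simp only [Set.mem_preimage, Set.mem_ofPred_eq, netScore, min_le_iff,
      directPathLoss_le_iff hα hτ, losScore_le_iff (Real.rpow_nonneg hτ _), Set.mem_union,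
      Set.mem_prod, Set.mem_compl_iff]
    by_cases h : Clear f 0 y
    · rw [iInf_indirectPathLoss_of_clear α ρ R h]
      simp [h]
    · rw [iInf_indirectPathLoss_of_not_clear α ρ R h]
      simp [h, hE]
  have hdisj : Disjoint (Prod.mk y ⁻¹' {p | losScore p ≤ ENNReal.ofReal (τ ^ (1 / α))})
      ({f | Clear f 0 y}ᶜ ×ˢ E) := by
    rw [Set.disjoint_left]
    rintro ⟨f, R⟩ h1 h2
    simp only [Set.mem_preimage, Set.mem_ofPred_eq, losScore_le_iff (Real.rpow_nonneg hτ _)] at h1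
    exact h2.1 h1.1
  rw [hset, measure_union hdisj (hcl.compl.prod hEm), markLaw_losScore_le hB (Real.rpow_nonneg hτ _),
    Measure.prod_prod, prob_compl_eq_one_sub hcl, hB, sub_zero, ← ENNReal.ofReal_one,
    ← ENNReal.ofReal_sub _ (by unfold pLoS; positivity)]

end Mark

/-! ### Radial integrals -/

lemma integral_id_mul_pLoS {β : ℝ} (hβ : 0 < β) (x : ℝ) :
    ∫ r in (0 : ℝ)..x, r * pLoS β r
      = 1 / β ^ 2 * (1 - (β * x + 1) * Real.exp (-(β * x))) := by
  have hd : ∀ r ∈ Set.uIcc 0 x, HasDerivAt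
      (fun r => -(1 / β ^ 2) * ((β * r + 1) * Real.exp (-(β * r)))) (r * pLoS β r) r := by
    intro r _
    have h1 : HasDerivAt (fun r : ℝ => β * r + 1) β r := by
      simpa using ((hasDerivAt_id r).const_mul β).add_const 1
    have h2 : HasDerivAt (fun r : ℝ => Real.exp (-(β * r))) (Real.exp (-(β * r)) * -β) r := by
      simpa using ((hasDerivAt_id r).const_mul β).neg.exp
    refine ((h1.mul h2).const_mul (-(1 / β ^ 2))).congr_deriv ?_
    rw [pLoS]
    field_simp
    ring
  rw [intervalIntegral.integral_eq_sub_of_hasDerivAt hd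
    (Continuous.intervalIntegrable (by unfold pLoS; fun_prop) _ _)]
  simp
  ring

lemma one_sub_cdfRd_exponent_nonneg {β : ℝ} (hβ : 0 < β) {x : ℝ} (hx : 0 ≤ x) :
    0 ≤ 1 / β ^ 2 * (1 - (β * x + 1) * Real.exp (-(β * x))) := by
  rw [← integral_id_mul_pLoS hβ]
  exact intervalIntegral.integral_nonneg hx fun r hr =>
    mul_nonneg hr.1 (by unfold pLoS; positivity)

lemma lintegral_pLoS_ball {β : ℝ} (hβ : 0 < β) {x : ℝ} (hx : 0 ≤ x) :
    ∫⁻ y : Plane, (if ‖y‖ ≤ x then ENNReal.ofReal (pLoS β ‖y‖) else 0)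
      = ENNReal.ofReal (2 * Real.pi * (1 / β ^ 2 * (1 - (β * x + 1) * Real.exp (-(β * x))))) := by
  have hm : Measurable fun r : ℝ => if r ≤ x then ENNReal.ofReal (pLoS β r) else 0 :=
    Measurable.ite measurableSet_Iic (measurable_pLoS β).ennreal_ofReal measurable_const
  rw [lintegral_plane_radial hm, ENNReal.ofReal_mul Real.two_pi_pos.le]
  congr 1
  rw [← integral_id_mul_pLoS hβ, intervalIntegral.integral_of_le hx,
    ofReal_integral_eq_lintegral_ofReal, ← lintegral_indicator measurableSet_Ioi,
    ← lintegral_indicator measurableSet_Ioc]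
  · refine lintegral_congr fun r => ?_
    simp only [Set.indicator_apply, Set.mem_Ioi, Set.mem_Ioc]
    by_cases h0 : 0 < r
    · by_cases h1 : r ≤ x
      · simp [h0, h1, ENNReal.ofReal_mul h0.le]
      · simp [h1]
    · simp [h0]
  · exact (Continuous.intervalIntegrable (by unfold pLoS; fun_prop) 0 x).1
  · exact (ae_restrict_iff' measurableSet_Ioc).2 (Eventually.of_forall fun r hr =>
      mul_nonneg hr.1.le (by unfold pLoS; positivity))

section Radial

variable {B : Measure BlockageField} [IsProbabilityMeasure B] {β lamR α τ : ℝ} {ρ : PMF ℕ}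

lemma measurable_risIntensity (t : ENNReal) :
    Measurable fun y => risIntensity lamR α ρ B y t :=
  measurable_measure_prodMk_left (measurableSet_le (measurable_risScore α ρ) measurable_const)

/-- At a point of norm `r` the product is the exponential of minus an RIS intensity. -/
lemma tprod_one_sub_cdfRik_mem (hβ : 0 < β) (hR : 0 ≤ lamR)
    (hB : ∀ a b, B {f | Clear f a b} = ENNReal.ofReal (pLoS β ‖b - a‖))
    (hα : 0 < α) (hτ : 0 ≤ τ) (hρ : ρ 0 = 0) {r : ℝ} (hr : 0 < r) :
    ∏' k : ρ.support, (1 - cdfRik β (lamR * (ρ k).toReal) r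
      (τ ^ (1 / α) * ((k : ℕ) : ℝ) ^ (2 / α))) ∈ Set.Icc (0 : ℝ) 1 := by
  have hn : ‖r • dir 0‖ = r := by rw [norm_smul, norm_dir, mul_one, Real.norm_of_nonneg hr.le]
  have hy : r • dir 0 ≠ 0 := by rw [← norm_ne_zero_iff, hn]; exact hr.ne'
  have h := exp_neg_toReal_risIntensity (lamR := lamR) hβ hR hB hα hτ hρ hy
  rw [hn] at h
  rw [← h]
  refine ⟨(Real.exp_pos _).le, ?_⟩
  rw [Real.exp_le_one_iff, neg_nonpos]
  exact ENNReal.toReal_nonneg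

lemma pLoS_le_one (hβ : 0 < β) {r : ℝ} (hr : 0 ≤ r) : pLoS β r ≤ 1 := by
  rw [pLoS, Real.exp_le_one_iff, neg_nonpos]; positivity

lemma integral_reflected_nonneg (hβ : 0 < β) (hR : 0 ≤ lamR)
    (hB : ∀ a b, B {f | Clear f a b} = ENNReal.ofReal (pLoS β ‖b - a‖))
    (hα : 0 < α) (hτ : 0 ≤ τ) (hρ : ρ 0 = 0) :
    0 ≤ ∫ r in Set.Ioi (0 : ℝ), (1 - pLoS β r) *
          (1 - ∏' k : ρ.support, (1 - cdfRik β (lamR * (ρ k).toReal) r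
            (τ ^ (1 / α) * ((k : ℕ) : ℝ) ^ (2 / α)))) * r := by
  refine setIntegral_nonneg measurableSet_Ioi fun r hr => ?_
  rw [Set.mem_Ioi] at hr
  exact mul_nonneg (mul_nonneg (sub_nonneg.2 (pLoS_le_one hβ hr.le))
    (sub_nonneg.2 (tprod_one_sub_cdfRik_mem hβ hR hB hα hτ hρ hr).2)) hr.le

/-- The integral over the plane of the probability that a base station can only be reached through
an RIS with path-loss at most `τ`. -/
lemma lintegral_reflected (hβ : 0 < β) (hR : 0 ≤ lamR)
    (hB : ∀ a b, B {f | Clear f a b} = ENNReal.ofReal (pLoS β ‖b - a‖))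
    (hα : 0 < α) (hτ : 0 ≤ τ) (hρ : ρ 0 = 0) :
    ∫⁻ y : Plane, ENNReal.ofReal (1 - pLoS β ‖y‖) *
        (1 - expNeg (risIntensity lamR α ρ B y (ENNReal.ofReal τ)))
      = ENNReal.ofReal (2 * Real.pi * ∫ r in Set.Ioi (0 : ℝ), (1 - pLoS β r) *
          (1 - ∏' k : ρ.support, (1 - cdfRik β (lamR * (ρ k).toReal) r
            (τ ^ (1 / α) * ((k : ℕ) : ℝ) ^ (2 / α)))) * r) := by
  set G : ℝ → ℝ := fun r => ∏' k : ρ.support, (1 - cdfRik β (lamR * (ρ k).toReal) r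
    (τ ^ (1 / α) * ((k : ℕ) : ℝ) ^ (2 / α))) with hG
  set T : Plane → ENNReal := fun y => risIntensity lamR α ρ B y (ENNReal.ofReal τ) with hT
  have hTm : Measurable T := measurable_risIntensity _
  have hTlt : ∀ y, T y < ⊤ := fun y => risIntensity_lt_top hβ hB hα hτ hρ y
  have hTG : ∀ y, y ≠ 0 → expNeg (T y) = ENNReal.ofReal (G ‖y‖) ∧ G ‖y‖ ∈ Set.Icc (0 : ℝ) 1 := by
    intro y hy
    have h := exp_neg_toReal_risIntensity (lamR := lamR) hβ hR hB hα hτ hρ hy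
    refine ⟨?_, tprod_one_sub_cdfRik_mem hβ hR hB hα hτ hρ (norm_pos_iff.2 hy)⟩
    rw [expNeg_eq_ofReal (hTlt y).ne, h]
  have hd := continuous_dir.measurable
  set e : ℝ → Plane := fun r => r • dir 0
  have he : Measurable e := by fun_prop
  have hen : ∀ r, 0 ≤ r → ‖e r‖ = r := fun r hr => by
    rw [norm_smul, norm_dir, mul_one, Real.norm_of_nonneg hr]
  have hne : ∀ᵐ y : Plane, y ≠ 0 := by simp [ae_iff]
  have hp : ∀ r, 0 ≤ r → 0 ≤ 1 - pLoS β r := fun r hr =>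
    sub_nonneg.2 (pLoS_le_one hβ hr)
  -- The radial profile is read off along the ray `e`: measurability then comes from `T`, and none
  -- has to be proved for the infinite product `G`.
  set h : ℝ → ENNReal := fun r => ENNReal.ofReal (1 - pLoS β r) * (1 - expNeg (T (e r))) with hh
  have hhm : Measurable h := (measurable_const.sub (measurable_pLoS β)).ennreal_ofReal.mul
    (measurable_const.sub (measurable_expNeg.comp (hTm.comp he)))
  have hrad : ∫⁻ y : Plane, ENNReal.ofReal (1 - pLoS β ‖y‖) * (1 - expNeg (T y))
      = ∫⁻ y : Plane, h ‖y‖ := by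
    refine lintegral_congr_ae ?_
    filter_upwards [hne] with y hy
    have hy' : e ‖y‖ ≠ 0 := by
      rw [← norm_ne_zero_iff, hen _ (norm_nonneg y)]; exact norm_ne_zero_iff.2 hy
    simp only [hh]
    rw [(hTG y hy).1, (hTG _ hy').1, hen _ (norm_nonneg y)]
  -- Finiteness lets the Bochner integral in `funH` represent this one instead of taking its default
  -- value `0`. It follows from `1 - exp (-s) ≤ s` and the exponential decay of the intensity.
  have hfin : ∫⁻ y : Plane, ENNReal.ofReal (1 - pLoS β ‖y‖) * (1 - expNeg (T y)) < ⊤ := by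
    set K := ∫⁻ z : Plane, ENNReal.ofReal (Real.exp (-(β / 2 * ‖z‖))) with hK
    have hKlt : K < ⊤ := lintegral_exp_neg_norm_lt_top (half_pos hβ)
    have hle : ∫⁻ y : Plane, ENNReal.ofReal (1 - pLoS β ‖y‖) * (1 - expNeg (T y))
        ≤ ∫⁻ y : Plane, ENNReal.ofReal lamR *
          (ENNReal.ofReal (Real.exp (-(β / 2 * ‖y‖))) * K) := by
      refine lintegral_mono fun y => ?_
      have h1 : ENNReal.ofReal (1 - pLoS β ‖y‖) ≤ 1 := by
        rw [ENNReal.ofReal_le_one]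
        have : 0 ≤ pLoS β ‖y‖ := by unfold pLoS; positivity
        linarith
      calc ENNReal.ofReal (1 - pLoS β ‖y‖) * (1 - expNeg (T y)) ≤ 1 * T y :=
            mul_le_mul' h1 (one_sub_expNeg_le _)
        _ ≤ _ := by rw [one_mul]; exact risIntensity_le hβ hB hα hτ hρ y
    refine hle.trans_lt ?_
    rw [lintegral_const_mul _ (by fun_prop), lintegral_mul_const _ (by fun_prop)]
    exact ENNReal.mul_lt_top ENNReal.ofReal_lt_top (ENNReal.mul_lt_top hKlt hKlt)
  rw [hrad, lintegral_plane_radial hhm] at hfin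
  rw [hrad, lintegral_plane_radial hhm, ENNReal.ofReal_mul Real.two_pi_pos.le]
  congr 1
  have hI : ∫⁻ r in Set.Ioi (0 : ℝ), ENNReal.ofReal r * h r < ⊤ := by
    by_contra htop
    rw [not_lt, top_le_iff] at htop
    rw [htop, ENNReal.mul_top (ENNReal.ofReal_pos.2 Real.two_pi_pos).ne'] at hfin
    exact hfin.ne rfl
  have hkm : Measurable fun r => ENNReal.ofReal r * h r :=
    (by fun_prop : Measurable fun r : ℝ => ENNReal.ofReal r).mul hhm
  rw [← ENNReal.ofReal_toReal hI.ne, ← integral_toReal hkm.aemeasurable (ae_lt_top hkm hI.ne)]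
  congr 1
  refine setIntegral_congr_fun measurableSet_Ioi fun r hr => ?_
  rw [Set.mem_Ioi] at hr
  have her : e r ≠ 0 := by rw [← norm_ne_zero_iff, hen r hr.le]; exact hr.ne'
  obtain ⟨h1, h3, h2⟩ := hTG _ her
  rw [hen r hr.le] at h1 h2 h3
  simp only [hh]
  rw [h1, ← ENNReal.ofReal_one, ← ENNReal.ofReal_sub _ h3, ← ENNReal.ofReal_mul (hp r hr.le),
    ← ENNReal.ofReal_mul hr.le, ENNReal.toReal_ofReal]
  · ring
  · exact mul_nonneg hr.le (mul_nonneg (hp r hr.le) (by linarith))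

end Radial

/-! ### The intensities of the covering base stations -/

lemma intensity_losScore {B : Measure BlockageField} [IsProbabilityMeasure B] {C : Measure RISField}
    [IsProbabilityMeasure C] {β lamBS : ℝ} (hβ : 0 < β) (hBS : 0 < lamBS)
    (hB : ∀ a b, B {f | Clear f a b} = ENNReal.ofReal (pLoS β ‖b - a‖)) {x : ℝ} (hx : 0 ≤ x) :
    ((ENNReal.ofReal lamBS • (volume : Measure Plane)).prod (B.prod C))
        {p | losScore p ≤ ENNReal.ofReal x}
      = ENNReal.ofReal (2 * Real.pi * lamBS * (1 / β ^ 2) *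
          (1 - (β * x + 1) * Real.exp (-(β * x)))) := by
  rw [Measure.prod_smul_left, Measure.smul_apply,
    Measure.prod_apply (measurableSet_le measurable_losScore measurable_const), smul_eq_mul]
  simp only [markLaw_losScore_le hB hx]
  rw [lintegral_pLoS_ball hβ hx, ← ENNReal.ofReal_mul hBS.le]
  congr 1
  ring

lemma cdfRd_mem {β lamBS : ℝ} (hβ : 0 < β) (hBS : 0 < lamBS) {x : ℝ} (hx : 0 ≤ x) :
    cdfRd lamBS β x ∈ Set.Icc (0 : ℝ) 1 := by
  have := one_sub_cdfRd_exponent_nonneg hβ hx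
  constructor
  · rw [cdfRd, sub_nonneg, Real.exp_le_one_iff, neg_nonpos, mul_assoc]
    positivity
  · rw [cdfRd, sub_le_self_iff]
    exact (Real.exp_pos _).le

lemma expNeg_losIntensity {β lamBS : ℝ} (hβ : 0 < β) (hBS : 0 < lamBS) {x : ℝ} (hx : 0 ≤ x) :
    expNeg (ENNReal.ofReal (2 * Real.pi * lamBS * (1 / β ^ 2) *
        (1 - (β * x + 1) * Real.exp (-(β * x)))))
      = ENNReal.ofReal (1 - cdfRd lamBS β x) := by
  rw [expNeg_ofReal, cdfRd, sub_sub_cancel]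
  have := one_sub_cdfRd_exponent_nonneg hβ hx
  have h : 0 ≤ 2 * Real.pi * lamBS := by positivity
  rw [mul_assoc]
  exact mul_nonneg h this

lemma intensity_netScore {QR : Measure (PointConfig Plane)} {B : Measure BlockageField}
    [IsProbabilityMeasure B] {β lamBS lamR α τ : ℝ} {ρ : PMF ℕ} (hQR : IsHomogeneousPPP QR lamR)
    (hβ : 0 < β) (hBS : 0 < lamBS) (hR : 0 ≤ lamR)
    (hB : ∀ a b, B {f | Clear f a b} = ENNReal.ofReal (pLoS β ‖b - a‖))
    (hα : 0 < α) (hτ : 0 ≤ τ) (hρ : ρ 0 = 0) :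
    ((ENNReal.ofReal lamBS • (volume : Measure Plane)).prod (B.prod (risLaw QR ρ B)))
        {p | netScore α ρ p ≤ ENNReal.ofReal τ}
      = ENNReal.ofReal (2 * Real.pi * lamBS * (1 / β ^ 2) *
          (1 - (β * τ ^ (1 / α) + 1) * Real.exp (-(β * τ ^ (1 / α))))) +
        ENNReal.ofReal (2 * Real.pi * lamBS * ∫ r in Set.Ioi (0 : ℝ), (1 - pLoS β r) *
          (1 - ∏' k : ρ.support, (1 - cdfRik β (lamR * (ρ k).toReal) r
            (τ ^ (1 / α) * ((k : ℕ) : ℝ) ^ (2 / α)))) * r) := by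
  have := isProbabilityMeasure_risLaw hQR ρ B
  rw [Measure.prod_smul_left, Measure.smul_apply,
    Measure.prod_apply (measurableSet_le (measurable_netScore α ρ) measurable_const), smul_eq_mul]
  simp only [markLaw_netScore_le hB hα hτ, risLaw_iInf_le hQR hβ hB hα hτ hρ]
  rw [lintegral_add_left, lintegral_pLoS_ball hβ (Real.rpow_nonneg hτ _),
    lintegral_reflected hβ hR hB hα hτ hρ, mul_add, ← ENNReal.ofReal_mul hBS.le,
    ← ENNReal.ofReal_mul hBS.le]
  · congr 2 <;> ring
  · exact Measurable.ite (measurableSet_le measurable_norm measurable_const)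
      ((measurable_pLoS β).comp measurable_norm).ennreal_ofReal measurable_const

/-- Association requires an attained minimum. Almost surely finitely many stations have loss at most
`τ`; if there is one, the best of them is best overall. -/
lemma coverageEvent_ae_eq {QS : Measure (PointConfig Plane)} {lamBS α τ : ℝ} {ρ : PMF ℕ}
    (hQS : IsHomogeneousPPP QS lamBS) (ν : Measure (BlockageField × RISField))
    [IsProbabilityMeasure ν]
    (hfin : ((ENNReal.ofReal lamBS • (volume : Measure Plane)).prod ν)
        {p | netScore α ρ p ≤ ENNReal.ofReal τ} ≠ ⊤) :
    coverageEvent α ρ τ =ᵐ[markedLaw QS ν] {N | ∃ n, Present N n ∧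
      (loc N n, mark N n) ∈ {p | netScore α ρ p ≤ ENNReal.ofReal τ}} := by
  filter_upwards [IsPoissonProcess.markedLaw_finite hQS ν
    (measurableSet_le (measurable_netScore α ρ) measurable_const) hfin] with N hN
  refine propext ⟨fun ⟨n, hn, hle⟩ => ⟨n, hn.1, hle⟩, fun ⟨n, hn⟩ => ?_⟩
  obtain ⟨m, hm, hmin⟩ := hN.exists_minimalFor (fun n => pathLoss α ρ N n) _ ⟨n, hn⟩
  refine ⟨m, ⟨hm.1, fun k hk => ?_⟩, hm.2⟩
  by_cases hk' : pathLoss α ρ N k ≤ ENNReal.ofReal τ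
  · by_contra hlt
    exact hlt (hmin ⟨hk, hk'⟩ (not_le.1 hlt).le)
  · exact le_trans hm.2 (not_le.1 hk').le

lemma nearestLoSDist_eq (N : Network) :
    nearestLoSDist N = ⨅ (n : ℕ) (_ : Present N n), losScore (loc N n, mark N n) := by
  classical
  simp only [nearestLoSDist, losScore, iInf_eq_if]

end RISNet

/-! ### The coverage theorem -/

theorem theorem4 (lamBS lamb mu Lmin Lmax α τ : ℝ) (ρ : PMF ℕ)
    (hBS : 0 < lamBS) (hb : 0 < lamb) (hmu0 : 0 ≤ mu) (hmu1 : mu ≤ 1)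
    (hL0 : 0 ≤ Lmin) (hL : Lmin < Lmax) (hα : 0 < α) (hτ : 0 ≤ τ) (hρ : ρ 0 = 0)
    (QS QR Qb : Measure (RISNet.PointConfig RISNet.Plane))
    (hQS : RISNet.IsHomogeneousPPP QS lamBS)
    (hQR : RISNet.IsHomogeneousPPP QR (mu * lamb))
    (hQb : RISNet.IsHomogeneousPPP Qb lamb) :
    (∀ x : ℝ, 0 ≤ x →
      (RISNet.networkLaw QS QR Qb ρ Lmin Lmax).real
          {N | RISNet.nearestLoSDist N ≤ ENNReal.ofReal x} =
        RISNet.cdfRd lamBS (RISNet.beta lamb Lmin Lmax) x) ∧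
    (RISNet.networkLaw QS QR Qb ρ Lmin Lmax).real (RISNet.coverageEvent α ρ τ) =
      1 - (1 - RISNet.cdfRd lamBS (RISNet.beta lamb Lmin Lmax) (τ ^ (1 / α))) *
        RISNet.funH lamBS (mu * lamb) (RISNet.beta lamb Lmin Lmax) α ρ (τ ^ (1 / α)) := by
  have hβ := RISNet.beta_pos hb hL0 hL
  have hR : 0 ≤ mu * lamb := mul_nonneg hmu0 hb.le
  have hB := RISNet.blockageLaw_clear hQb hb hL0 hL
  have := RISNet.isProbabilityMeasure_blockageLaw hQb hL
  have := RISNet.isProbabilityMeasure_risLaw hQR ρ (RISNet.blockageLaw Qb Lmin Lmax)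
  set β := RISNet.beta lamb Lmin Lmax
  refine ⟨fun x hx => ?_, ?_⟩
  · have h := RISNet.IsPoissonProcess.markedLaw_iInf_le hQS
      ((RISNet.blockageLaw Qb Lmin Lmax).prod (RISNet.risLaw QR ρ (RISNet.blockageLaw Qb Lmin Lmax)))
      RISNet.measurable_losScore (t := ENNReal.ofReal x) (t' := ENNReal.ofReal (x + 1))
      ((ENNReal.ofReal_lt_ofReal_iff (by linarith)).2 (by linarith)) (by
        rw [RISNet.intensity_losScore hβ hBS hB (by linarith)]
        exact ENNReal.ofReal_ne_top)
    have hmem := RISNet.cdfRd_mem hβ hBS hx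
    rw [RISNet.intensity_losScore hβ hBS hB hx, RISNet.expNeg_losIntensity hβ hBS hx,
      ← ENNReal.ofReal_one, ← ENNReal.ofReal_sub _ (sub_nonneg.2 hmem.2), sub_sub_cancel] at h
    simp only [RISNet.nearestLoSDist_eq]
    rw [measureReal_def, RISNet.networkLaw, h, ENNReal.toReal_ofReal hmem.1]
  · have hint := RISNet.intensity_netScore hQR hβ hBS hR hB hα hτ hρ
    have hJ : 0 ≤ 2 * Real.pi * lamBS * ∫ r in Set.Ioi (0 : ℝ), (1 - RISNet.pLoS β r) *
          (1 - ∏' k : ρ.support, (1 - RISNet.cdfRik β (mu * lamb * (ρ k).toReal) r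
            (τ ^ (1 / α) * ((k : ℕ) : ℝ) ^ (2 / α)))) * r :=
      mul_nonneg (by positivity) (RISNet.integral_reflected_nonneg hβ hR hB hα hτ hρ)
    have hmem := RISNet.cdfRd_mem hβ hBS (Real.rpow_nonneg hτ (1 / α))
    -- Coverage is the complement of a void event with intensity direct plus reflected; `expNeg_add`
    -- turns this sum into the product `(1 - F_{R_d}) * H`.
    rw [measureReal_def, RISNet.networkLaw, measure_congr (RISNet.coverageEvent_ae_eq hQS _
      (by rw [hint]; exact ENNReal.add_ne_top.2 ⟨ENNReal.ofReal_ne_top, ENNReal.ofReal_ne_top⟩)),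
      RISNet.IsPoissonProcess.markedLaw_exists hQS _
        (measurableSet_le (RISNet.measurable_netScore α ρ) measurable_const), hint,
      RISNet.expNeg_add, RISNet.expNeg_losIntensity hβ hBS (Real.rpow_nonneg hτ _),
      RISNet.expNeg_ofReal hJ, ← ENNReal.ofReal_mul (sub_nonneg.2 hmem.2), ← ENNReal.ofReal_one,
      ← ENNReal.ofReal_sub _ (mul_nonneg (sub_nonneg.2 hmem.2) (Real.exp_pos _).le),
      ENNReal.toReal_ofReal, RISNet.funH]
    exact sub_nonneg.2 (mul_le_one₀ (sub_le_self _ hmem.1) (Real.exp_pos _).le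
      (Real.exp_le_one_iff.2 (neg_nonpos.2 hJ)))
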